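/- **Hidden steering of the doubly flagged Werner state.** Conventions. For a state $\rho$ on $\mathbb{C}^m\otimes\mathbb{C}^n$ (first factor Alice, second Bob) and POVMs $\{M_{a|x}\}_a$ of Alice (finitely many outcomes, arbitrary set of settings $x$), the assemblage is $\sigma_{a|x}=\mathrm{tr}_A[(M_{a|x}\otimes\mathbb{I})\rho]$. It has a local-hidden-state (LHS) decomposition if $\sigma_{a|x}=\int d\mu(\lambda)\,p(a|x,\lambda)\,\sigma_\lambda$ for a probability measure $\mu$, response functions $p(\cdot|x,\lambda)$ and quantum states $\sigma_\lambda$. The state $\rho$ has an LHS model for POVMs from Alice to Bob if every assemblage obtained from POVMs has such a decomposition (the family of all POVMs at once included); otherwise $\rho$ is steerable from Alice to Bob. From Bob to Alice is defined by exchanging the parties. Let $d\ge 2$, and let $$\tilde\rho_W=\alpha\,\frac{2P^{anti}}{d(d-1)}+(1-\alpha)\frac{\mathbb{I}_{d^2}}{d^2},\qquad \alpha=\frac{d-1}{d},$$ be the Werner state on $\mathbb{C}^d\otimes\mathbb{C}^d$, where $P^{anti}$ is the projector on the antisymmetric subspace. For a state $\rho$ whose first party has dimension $d$, with reduced state $\rho_B=\mathrm{tr}_A\rho$,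 the flag extension on Alice's side is $\frac{1}{d+1}[\rho+d\,P_\perp\otimes\rho_B]$, where $P_\perp=|d\rangle\langle d|$ projects on one additional dimension of Alice's system $\mathbb{C}^{d+1}=\mathbb{C}^d\oplus\mathbb{C}|d\rangle$; the extension on Bob's side is defined in the same way. Let $\rho_{HS}$, on $\mathbb{C}^{d+1}\otimes\mathbb{C}^{d+1}$, be obtained from $\tilde\rho_W$ by the flag extension first on Alice's side and then on Bob's side. Then: 1. $\rho_{HS}$ is a quantum state, and, with $\mathbb{I}_d$ the projector on $\mathbb{C}^d\subset\mathbb{C}^{d+1}$, $$\rho_{HS}=\frac{1}{(d+1)^2}\Big[\tilde\rho_W+d\Big(P_\perp\otimes\frac{\mathbb{I}_d}{d}+\frac{\mathbb{I}_d}{d}\otimes P_\perp\Big)+d^2P_\perp\otimes P_\perp\Big].$$ 2. $\rho_{HS}$ has LHS models for POVMs from Alice to Bob and from Bob to Alice. 3. With the local filters $F_A=F_B=|0\rangle\langle0|+|1\rangle\langle1|$ one has $\mathrm{tr}[(F_A\otimes F_B)\rho_{HS}(F_A^\dagger\otimes F_B^\dagger)]\neq0$ and $$\frac{(F_A\otimes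 F_B)\rho_{HS}(F_A^\dagger\otimes F_B^\dagger)}{\mathrm{tr}[(F_A\otimes F_B)\rho_{HS}(F_A^\dagger\otimes F_B^\dagger)]}=\frac{1}{1+\frac2d}\Big[|\psi^-\rangle\langle\psi^-|+\frac2d\,\frac{\mathbb{I}_4}{4}\Big],\qquad |\psi^-\rangle=\frac{|01\rangle-|10\rangle}{\sqrt2},$$ the two-qubit Werner state with visibility $1/(1+2/d)$ on the span of $|0\rangle,|1\rangle$ on each side. 4. If $d\ge3$, this filtered state is steerable (using POVMs) both from Alice to Bob and from Bob to Alice, whether regarded as a two-qubit state or as a state on $\mathbb{C}^{d+1}\otimes\mathbb{C}^{d+1}$. Hence $\rho_{HS}$ has hidden steering: it has LHS models for POVMs in both directions, but there are first-round local measurements, given by Kraus operators, and a pair of outcomes of non-zero probability after which the post-measurement state is steerable. -/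

import Mathlib

open scoped Kronecker Matrix ComplexOrder
open MeasureTheory

noncomputable section

namespace Steering

/-! Finite-dimensional Hilbert spaces are `ℂ^m` for a finite index type `m`. An operator on
`ℂ^m ⊗ ℂ^n` is a matrix indexed by `m × n`; the first factor is Alice's, the second Bob's. -/

/-- Density matrices (quantum states). -/
def IsDensity {n : Type*} [Fintype n] (ρ : Matrix n n ℂ) : Prop :=
  ρ.PosSemidef ∧ ρ.trace = 1

/-- Partial trace over Alice's system. -/
def ptraceA {m n : Type*} [Fintype m] (ρ : Matrix (m × n) (m × n) ℂ) : Matrix n n ℂ :=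
  Matrix.of fun i j => ∑ k, ρ (k, i) (k, j)

/-- The same operator with the roles of Alice and Bob exchanged. -/
def exchange {m n : Type*} (ρ : Matrix (m × n) (m × n) ℂ) : Matrix (n × m) (n × m) ℂ :=
  ρ.submatrix Prod.swap Prod.swap

/-- A POVM on `ℂ^m` with `k` outcomes. -/
structure POVM (k : ℕ) (m : Type*) [Fintype m] [DecidableEq m] where
  elem : Fin k → Matrix m m ℂ
  posSemidef : ∀ a, (elem a).PosSemidef
  sum_eq_one : ∑ a, elem a = 1

/-- The assemblage `σ_{a|x} = tr_A((M_{a|x} ⊗ 𝟙) ρ)` that Alice prepares on Bob's side by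
performing on `ρ` the measurements `M x`, where `x` ranges over an arbitrary set of settings. -/
def assemblage {m n : Type*} [Fintype m] [DecidableEq m] [Fintype n] [DecidableEq n]
    (ρ : Matrix (m × n) (m × n) ℂ) {X : Type} {k : X → ℕ} (M : ∀ x, POVM (k x) m)
    (x : X) (a : Fin (k x)) : Matrix n n ℂ :=
  ptraceA (((M x).elem a ⊗ₖ (1 : Matrix n n ℂ)) * ρ)

/-- `σ_{a|x} = ∫ dμ(λ) p(a|x,λ) σ_λ` for a hidden variable `λ` distributed according to a
probability measure `μ`, local response functions `p(·|x,λ)` and quantum states `σ_λ`. -/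
def HasLHSDecomposition {n : Type*} [Fintype n] {X : Type} {k : X → ℕ}
    (σ : ∀ x, Fin (k x) → Matrix n n ℂ) : Prop :=
  ∃ (Λ : Type) (_ : MeasurableSpace Λ) (μ : Measure Λ) (p : ∀ x, Fin (k x) → Λ → ℝ)
    (τ : Λ → Matrix n n ℂ),
    IsProbabilityMeasure μ ∧
    (∀ x a, Measurable (p x a)) ∧
    (∀ x a l, 0 ≤ p x a l) ∧
    (∀ x l, ∑ a, p x a l = 1) ∧
    (∀ i j, Measurable fun l => τ l i j) ∧
    (∀ l, IsDensity (τ l)) ∧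
    ∀ x a i j, σ x a i j = ∫ l, (p x a l : ℂ) * τ l i j ∂μ

/-- `ρ` is unsteerable from Alice to Bob, i.e. admits an LHS model for POVMs. The family `M` may
consist of all POVMs at once, so that a single hidden variable serves for all of them. -/
def UnsteerableAB {m n : Type*} [Fintype m] [DecidableEq m] [Fintype n] [DecidableEq n]
    (ρ : Matrix (m × n) (m × n) ℂ) : Prop :=
  ∀ (X : Type) (k : X → ℕ) (M : ∀ x, POVM (k x) m), HasLHSDecomposition (assemblage ρ M)

/-- `ρ` is unsteerable from Bob to Alice. -/
def UnsteerableBA {m n : Type*} [Fintype m] [DecidableEq m] [Fintype n] [DecidableEq n]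
    (ρ : Matrix (m × n) (m × n) ℂ) : Prop :=
  UnsteerableAB (exchange ρ)

/-- Alice can steer Bob: for some set of POVMs the assemblage has no LHS decomposition. -/
def SteerableAB {m n : Type*} [Fintype m] [DecidableEq m] [Fintype n] [DecidableEq n]
    (ρ : Matrix (m × n) (m × n) ℂ) : Prop :=
  ∃ (X : Type) (k : X → ℕ) (M : ∀ x, POVM (k x) m), ¬ HasLHSDecomposition (assemblage ρ M)

/-- Bob can steer Alice. -/
def SteerableBA {m n : Type*} [Fintype m] [DecidableEq m] [Fintype n] [DecidableEq n]
    (ρ : Matrix (m × n) (m × n) ℂ) : Prop :=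
  SteerableAB (exchange ρ)

/-- The unnormalised state `(F_A ⊗ F_B) ρ (F_A† ⊗ F_B†)`; its trace is the probability that both
filters succeed. -/
def filterRaw {m n : Type*} [Fintype m] [Fintype n] (FA : Matrix m m ℂ) (FB : Matrix n n ℂ)
    (ρ : Matrix (m × n) (m × n) ℂ) : Matrix (m × n) (m × n) ℂ :=
  (FA ⊗ₖ FB) * ρ * (FAᴴ ⊗ₖ FBᴴ)

/-- The normalised state after successful local filtering on both sides. -/
def filtered {m n : Type*} [Fintype m] [Fintype n] (FA : Matrix m m ℂ) (FB : Matrix n n ℂ)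
    (ρ : Matrix (m × n) (m × n) ℂ) : Matrix (m × n) (m × n) ℂ :=
  ((filterRaw FA FB ρ).trace)⁻¹ • filterRaw FA FB ρ

/-- A (non-destructive) quantum measurement with `k` outcomes, given by its Kraus operators. -/
structure LocalMeasurement (k : ℕ) (m : Type*) [Fintype m] [DecidableEq m] where
  kraus : Fin k → Matrix m m ℂ
  complete : ∑ i, (kraus i)ᴴ * kraus i = 1

/-- Hidden steering: the state admits LHS models for POVMs in both directions, but after a first
round of local measurements by Alice and Bob the post-measurement state, for some pair of outcomes
of non-zero probability, is steerable by a second round of measurements. -/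
def HasHiddenSteering {m n : Type*} [Fintype m] [DecidableEq m] [Fintype n] [DecidableEq n]
    (ρ : Matrix (m × n) (m × n) ℂ) : Prop :=
  UnsteerableAB ρ ∧ UnsteerableBA ρ ∧
    ∃ (k l : ℕ) (A : LocalMeasurement k m) (B : LocalMeasurement l n) (i : Fin k) (j : Fin l),
      (filterRaw (A.kraus i) (B.kraus j) ρ).trace ≠ 0 ∧
      (SteerableAB (filtered (A.kraus i) (B.kraus j) ρ) ∨
        SteerableBA (filtered (A.kraus i) (B.kraus j) ρ))

/-- The swap operator `|i j⟩ ↦ |j i⟩` on `ℂ^d ⊗ ℂ^d`. -/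
def swapOp (d : ℕ) : Matrix (Fin d × Fin d) (Fin d × Fin d) ℂ :=
  Matrix.of fun p q => if p = q.swap then 1 else 0

/-- The projector on the antisymmetric subspace of `ℂ^d ⊗ ℂ^d`. -/
def antiProj (d : ℕ) : Matrix (Fin d × Fin d) (Fin d × Fin d) ℂ :=
  (1 / 2 : ℝ) • (1 - swapOp d)

/-- The Werner state `α 2 P^anti / (d (d - 1)) + (1 - α) 𝟙 / d²`. -/
def werner (d : ℕ) (α : ℝ) : Matrix (Fin d × Fin d) (Fin d × Fin d) ℂ :=
  (α * (2 / ((d : ℝ) * ((d : ℝ) - 1)))) • antiProj d + ((1 - α) * (1 / (d : ℝ) ^ 2)) • 1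

/-- The inclusion of `ℂ^m` in `ℂ^m ⊕ ℂ`. -/
def incl (m : Type*) [DecidableEq m] : Matrix (m ⊕ Unit) m ℂ :=
  Matrix.fromRows 1 0

/-- The projector `P_⊥` on the additional (flag) dimension of `ℂ^m ⊕ ℂ`. -/
def flagProj (m : Type*) [DecidableEq m] : Matrix (m ⊕ Unit) (m ⊕ Unit) ℂ :=
  Matrix.single (Sum.inr ()) (Sum.inr ()) 1

/-- Flag extension on Alice's side: `(ρ + d P_⊥ ⊗ ρ_B) / (d + 1)`, with `d` the dimension of
Alice's system. -/
def flagA {m n : Type*} [Fintype m] [DecidableEq m] [Fintype n] [DecidableEq n]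
    (ρ : Matrix (m × n) (m × n) ℂ) : Matrix ((m ⊕ Unit) × n) ((m ⊕ Unit) × n) ℂ :=
  (1 / ((Fintype.card m : ℝ) + 1)) •
    ((incl m ⊗ₖ (1 : Matrix n n ℂ)) * ρ * (incl m ⊗ₖ (1 : Matrix n n ℂ))ᴴ
      + (Fintype.card m : ℝ) • (flagProj m ⊗ₖ ptraceA ρ))

/-- Flag extension on Bob's side. -/
def flagB {m n : Type*} [Fintype m] [DecidableEq m] [Fintype n] [DecidableEq n]
    (ρ : Matrix (m × n) (m × n) ℂ) : Matrix (m × (n ⊕ Unit)) (m × (n ⊕ Unit)) ℂ :=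
  exchange (flagA (exchange ρ))

/-- The doubly flagged Werner state: the flag extension, first on Alice's and then on Bob's side,
of the Werner state with `α = (d - 1) / d`. -/
def rhoHS (d : ℕ) :
    Matrix ((Fin d ⊕ Unit) × (Fin d ⊕ Unit)) ((Fin d ⊕ Unit) × (Fin d ⊕ Unit)) ℂ :=
  flagB (flagA (werner d (((d : ℝ) - 1) / d)))

/-- The inclusion of the qubit space `ℂ²` in `ℂ^d ⊕ ℂ` as the span of `|0⟩` and `|1⟩`. -/
def qubitIncl {d : ℕ} (hd : 2 ≤ d) : Matrix (Fin d ⊕ Unit) (Fin 2) ℂ :=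
  ∑ k : Fin 2, Matrix.single (Sum.inl (Fin.castLE hd k)) k 1

/-- The local filter `|0⟩⟨0| + |1⟩⟨1|` on `ℂ^d ⊕ ℂ`. -/
def qubitFilter {d : ℕ} (hd : 2 ≤ d) : Matrix (Fin d ⊕ Unit) (Fin d ⊕ Unit) ℂ :=
  ∑ k : Fin 2, Matrix.single (Sum.inl (Fin.castLE hd k)) (Sum.inl (Fin.castLE hd k)) 1

/-- The singlet vector `|ψ⁻⟩ = (|01⟩ - |10⟩) / √2`. -/
def singletVec : Fin 2 × Fin 2 → ℂ :=
  ((1 / Real.sqrt 2 : ℝ) : ℂ) • (Pi.single (0, 1) 1 - Pi.single (1, 0) 1)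

/-- The singlet state `|ψ⁻⟩⟨ψ⁻|`. -/
def singlet : Matrix (Fin 2 × Fin 2) (Fin 2 × Fin 2) ℂ :=
  Matrix.vecMulVec singletVec (star singletVec)

end Steering

end

/-!
The hidden variable is a Gaussian vector `z` of `ℂ^d`, size-biased by `‖z‖²`, and Bob holds
the pure state along `z`. Write an effect as `N = ∑ ηᵢ uᵢ uᵢᴴ` in an orthonormal eigenbasis;
Werner's response to it is the total weight `ηᵢ` of those `i` for which `⟨uᵢ, z⟩` has the smallest
modulus among the components of `z` in this basis. The Gaussian moments of the
smallest coordinate turn this into the assemblage of the Werner state at `α = (d - 1) / d`. These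
responses are bounded by `tr N`, so over a POVM they only sum to at most `d` instead of `1`. The
flag absorbs the excess: Alice divides her responses by `d + 1` and otherwise behaves as if she had
found her flag, which Bob cannot notice because flagged Alice is uncorrelated with him. Flagging
Bob's side is a channel acting on his system only, so it preserves the decomposition, and the
symmetry of the state under exchange of the parties gives the other direction.

Filtering removes the flags and compresses the antisymmetric projector of `ℂ^d ⊗ ℂ^d` to that of
two qubits, while the noise loses most of its weight: the visibility becomes `1 / (1 + 2 / d)`,
which exceeds `1 / √3` for `d ≥ 3` and so violates the linear steering inequality for the three
Pauli measurements. Steerability survives the embedding into `ℂ^(d+1) ⊗ ℂ^(d+1)`, because Alice's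
POVMs extend and Bob's assemblage is pulled back by a channel.
-/

namespace Steering

/-! ### Entrywise integrals of matrices -/

/-- The integral of a matrix-valued function, taken entry by entry: matrices carry no canonical
norm, so that the Bochner integral is not available for them. -/
noncomputable def entryIntegral {Λ m n : Type*} [MeasurableSpace Λ] (μ : Measure Λ)
    (F : Λ → Matrix m n ℂ) : Matrix m n ℂ :=
  Matrix.of fun i j => ∫ l, F l i j ∂μ

section EntryIntegral

variable {Λ m n m' n' : Type*} [MeasurableSpace Λ] {μ : Measure Λ} {F G : Λ → Matrix m n ℂ}

theorem entryIntegral_add (hF : ∀ i j, Integrable (fun l => F l i j) μ)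
    (hG : ∀ i j, Integrable (fun l => G l i j) μ) :
    entryIntegral μ (fun l => F l + G l) = entryIntegral μ F + entryIntegral μ G := by
  ext i j
  exact integral_add (hF i j) (hG i j)

theorem entryIntegral_sum {ι : Type*} (s : Finset ι) {F : ι → Λ → Matrix m n ℂ}
    (hF : ∀ a ∈ s, ∀ i j, Integrable (fun l => F a l i j) μ) :
    entryIntegral μ (fun l => ∑ a ∈ s, F a l) = ∑ a ∈ s, entryIntegral μ (F a) := by
  ext i j
  simp only [entryIntegral, Matrix.sum_apply, Matrix.of_apply]
  exact integral_finsetSum _ fun a ha => hF a ha i j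

theorem entryIntegral_smul (c : ℝ) (F : Λ → Matrix m n ℂ) :
    entryIntegral μ (fun l => c • F l) = c • entryIntegral μ F := by
  ext i j
  exact integral_smul c _

theorem map_eq_sum_apply_mul [Fintype m] [Fintype n] [DecidableEq m] [DecidableEq n]
    (L : Matrix m n ℂ →ₗ[ℂ] ℂ) (M : Matrix m n ℂ) :
    L M = ∑ i, ∑ j, M i j * L (Matrix.single i j 1) := by
  conv_lhs => rw [Matrix.matrix_eq_sum_single M]
  simp only [map_sum]
  refine Finset.sum_congr rfl fun i _ => Finset.sum_congr rfl fun j _ => ?_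
  rw [← smul_eq_mul, ← map_smul, Matrix.smul_single, smul_eq_mul, mul_one]

theorem measurable_map_of_measurable_apply [Finite m] [Finite n] (L : Matrix m n ℂ →ₗ[ℂ] ℂ)
    (hF : ∀ i j, Measurable fun l => F l i j) : Measurable fun l => L (F l) := by
  classical
  cases nonempty_fintype m
  cases nonempty_fintype n
  simp_rw [map_eq_sum_apply_mul L (F _)]
  fun_prop

theorem integrable_map_of_integrable_apply [Finite m] [Finite n] (L : Matrix m n ℂ →ₗ[ℂ] ℂ)
    (hF : ∀ i j, Integrable (fun l => F l i j) μ) : Integrable (fun l => L (F l)) μ := by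
  classical
  cases nonempty_fintype m
  cases nonempty_fintype n
  simp_rw [map_eq_sum_apply_mul L (F _)]
  exact integrable_finsetSum _ fun i _ => integrable_finsetSum _ fun j _ => (hF i j).mul_const _

theorem map_entryIntegral [Finite m] [Finite n] (L : Matrix m n ℂ →ₗ[ℂ] ℂ)
    (hF : ∀ i j, Integrable (fun l => F l i j) μ) :
    L (entryIntegral μ F) = ∫ l, L (F l) ∂μ := by
  classical
  cases nonempty_fintype m
  cases nonempty_fintype n
  simp_rw [map_eq_sum_apply_mul L (F _)]
  rw [map_eq_sum_apply_mul L,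
    integral_finsetSum _ fun i _ => integrable_finsetSum _ fun j _ => (hF i j).mul_const _]
  refine Finset.sum_congr rfl fun i _ => ?_
  rw [integral_finsetSum _ fun j _ => (hF i j).mul_const _]
  exact Finset.sum_congr rfl fun j _ => (integral_mul_const _ _).symm

theorem map_entryIntegral_matrix [Finite m] [Finite n]
    (Φ : Matrix m n ℂ →ₗ[ℂ] Matrix m' n' ℂ) (hF : ∀ i j, Integrable (fun l => F l i j) μ) :
    Φ (entryIntegral μ F) = entryIntegral μ fun l => Φ (F l) := by
  ext i j
  exact map_entryIntegral (Matrix.entryLinearMap ℂ ℂ i j ∘ₗ Φ) hF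

end EntryIntegral

/-! ### Gaussian moments of the minimal coordinate -/

theorem setIntegral_le_norm {E : Type*} [NormedAddCommGroup E] [NormedSpace ℝ E]
    [FiniteDimensional ℝ E] [MeasurableSpace E] [BorelSpace E] [Nontrivial E] (μ : Measure E)
    [μ.IsAddHaarMeasure] (f : ℝ → ℝ) {r : ℝ} (hr : 0 ≤ r) :
    ∫ x in {x : E | r ≤ ‖x‖}, f ‖x‖ ∂μ =
      Module.finrank ℝ E * μ.real (Metric.ball 0 1) *
        ∫ y in Set.Ioi r, y ^ (Module.finrank ℝ E - 1) * f y := by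
  have htail : ∫ x in {x : E | r ≤ ‖x‖}, f ‖x‖ ∂μ = ∫ x, (Set.Ici r).indicator f ‖x‖ ∂μ :=
    (integral_indicator (measurableSet_le measurable_const measurable_norm)).symm
  have hradial : ∀ y : ℝ, y ^ (Module.finrank ℝ E - 1) • (Set.Ici r).indicator f y =
      (Set.Ici r).indicator (fun y => y ^ (Module.finrank ℝ E - 1) * f y) y := fun y => by
    by_cases hy : y ∈ Set.Ici r <;> simp [hy]
  rw [htail, integral_fun_norm_addHaar, nsmul_eq_mul, smul_eq_mul, mul_assoc]
  simp_rw [hradial]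
  rw [← integral_Ici_eq_integral_Ioi, setIntegral_indicator measurableSet_Ici,
    Set.Ici_inter_Ici, sup_of_le_right hr, integral_Ici_eq_integral_Ioi]

theorem setIntegral_complex_le_norm {f F : ℝ → ℝ} {r : ℝ} (hr : 0 ≤ r)
    (hF : ∀ y, HasDerivAt F (y * f y) y) (hf : ∀ y, 0 ≤ f y)
    (hlim : Filter.Tendsto F Filter.atTop (nhds 0)) :
    ∫ z in {z : ℂ | r ≤ ‖z‖}, f ‖z‖ = 2 * Real.pi * -F r := by
  have hball : (volume : Measure ℂ).real (Metric.ball 0 1) = Real.pi := by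
    simp [Measure.real, Complex.volume_ball]
  rw [setIntegral_le_norm volume f hr, Complex.finrank_real_complex, hball]
  simp only [Nat.add_one_sub_one, pow_one, Nat.cast_ofNat]
  rw [integral_Ioi_of_hasDerivAt_of_nonneg' (fun y _ => hF y)
    (fun y hy => mul_nonneg (hr.trans (le_of_lt hy)) (hf y)) hlim, zero_sub]

theorem hasDerivAt_exp_neg_mul_sq (b y : ℝ) :
    HasDerivAt (fun y => Real.exp (-(b * y ^ 2))) (Real.exp (-(b * y ^ 2)) * -(b * (2 * y))) y := by
  simpa using (((hasDerivAt_pow 2 y).const_mul b).neg).exp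

theorem tendsto_pow_mul_exp_neg_mul_sq {b : ℝ} (hb : 0 < b) (n : ℕ) :
    Filter.Tendsto (fun y : ℝ => (b * y ^ 2) ^ n * Real.exp (-(b * y ^ 2))) Filter.atTop (nhds 0) :=
  (Real.tendsto_pow_mul_exp_neg_atTop_nhds_zero n).comp
    ((Filter.tendsto_pow_atTop two_ne_zero).const_mul_atTop hb)

theorem setIntegral_le_norm_exp {b r : ℝ} (hb : 0 < b) (hr : 0 ≤ r) :
    ∫ z in {z : ℂ | r ≤ ‖z‖}, Real.exp (-(b * ‖z‖ ^ 2)) =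
      Real.pi * (1 / b * Real.exp (-(b * r ^ 2))) := by
  rw [setIntegral_complex_le_norm (f := fun y => Real.exp (-(b * y ^ 2)))
    (F := fun y => Real.exp (-(b * y ^ 2)) * (-1 / (2 * b))) hr
    (fun y => ((hasDerivAt_exp_neg_mul_sq b y).mul_const _).congr_deriv (by field_simp))
    (fun y => by positivity)
    (by simpa using (tendsto_pow_mul_exp_neg_mul_sq hb 0).mul_const (-1 / (2 * b)))]
  field_simp

theorem setIntegral_le_norm_sq_mul_exp {b r : ℝ} (hb : 0 < b) (hr : 0 ≤ r) :
    ∫ z in {z : ℂ | r ≤ ‖z‖}, ‖z‖ ^ 2 * Real.exp (-(b * ‖z‖ ^ 2)) =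
      Real.pi * ((1 / b ^ 2 + r ^ 2 / b) * Real.exp (-(b * r ^ 2))) := by
  have hderiv (y : ℝ) : HasDerivAt
      (fun y => (1 + b * y ^ 2) * Real.exp (-(b * y ^ 2)) * (-1 / (2 * b ^ 2)))
      (y * (y ^ 2 * Real.exp (-(b * y ^ 2)))) y := by
    refine (((((hasDerivAt_pow 2 y).const_mul b).const_add 1).mul
      (hasDerivAt_exp_neg_mul_sq b y)).mul_const (-1 / (2 * b ^ 2))).congr_deriv ?_
    field_simp
    push_cast
    ring
  have hlim := ((tendsto_pow_mul_exp_neg_mul_sq hb 0).add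
    (tendsto_pow_mul_exp_neg_mul_sq hb 1)).mul_const (-1 / (2 * b ^ 2))
  rw [setIntegral_complex_le_norm (f := fun y => y ^ 2 * Real.exp (-(b * y ^ 2))) hr hderiv
    (fun y => by positivity) (by simpa [add_mul] using hlim)]
  field_simp

theorem integral_complex_exp_neg_mul_sq {b : ℝ} (hb : 0 < b) :
    ∫ z : ℂ, Real.exp (-(b * ‖z‖ ^ 2)) = Real.pi / b := by
  simpa [div_eq_mul_inv] using setIntegral_le_norm_exp hb le_rfl

theorem integral_complex_sq_mul_exp_neg_mul_sq {b : ℝ} (hb : 0 < b) :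
    ∫ z : ℂ, ‖z‖ ^ 2 * Real.exp (-(b * ‖z‖ ^ 2)) = Real.pi / b ^ 2 := by
  simpa [div_eq_mul_inv] using setIntegral_le_norm_sq_mul_exp hb le_rfl

theorem integrable_complex_exp_neg_mul_sq {b : ℝ} (hb : 0 < b) :
    Integrable fun z : ℂ => Real.exp (-(b * ‖z‖ ^ 2)) :=
  .of_integral_ne_zero (by rw [integral_complex_exp_neg_mul_sq hb]; positivity)

theorem integrable_complex_sq_mul_exp_neg_mul_sq {b : ℝ} (hb : 0 < b) :
    Integrable fun z : ℂ => ‖z‖ ^ 2 * Real.exp (-(b * ‖z‖ ^ 2)) :=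
  .of_integral_ne_zero (by rw [integral_complex_sq_mul_exp_neg_mul_sq hb]; positivity)

/-- The indicator function of the set where the `i`-th coordinate has minimal modulus. -/
noncomputable def minIndicator {ι : Type*} (i : ι) : (ι → ℂ) → ℝ :=
  {z | ∀ j, ‖z i‖ ≤ ‖z j‖}.indicator 1

section MinIndicator

variable {ι : Type*} (i : ι) (z : ι → ℂ)

theorem minIndicator_nonneg : 0 ≤ minIndicator i z :=
  Set.indicator_nonneg (fun _ _ => zero_le_one) z

theorem minIndicator_le_one : minIndicator i z ≤ 1 :=
  Set.indicator_le_self' (fun _ _ => zero_le_one) z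

theorem minIndicator_congr {z w : ι → ℂ} (h : ∀ j, ‖z j‖ = ‖w j‖) :
    minIndicator i z = minIndicator i w := by
  classical simp [minIndicator, Set.indicator_apply, h]

theorem measurable_minIndicator [Countable ι] : Measurable (minIndicator i) := by
  refine measurable_one.indicator ?_
  rw [Set.ofPred_forall]
  exact MeasurableSet.iInter fun j => measurableSet_le (by fun_prop) (by fun_prop)

end MinIndicator

theorem minIndicator_insertNth {n : ℕ} (i : Fin (n + 1)) (x : ℂ) (y : Fin n → ℂ) :
    minIndicator i (i.insertNth x y : Fin (n + 1) → ℂ) =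
      ∏ j, {w : ℂ | ‖x‖ ≤ ‖w‖}.indicator (1 : ℂ → ℝ) (y j) := by
  classical
  simp [minIndicator, Set.indicator_apply, Fin.forall_iff_succAbove i, Finset.prod_boole]

/-- Given the value `x` of the minimal coordinate, the other coordinates range independently over
the exterior of the disc of radius `‖x‖`. -/
theorem integral_minIndicator_mul_prod {n : ℕ} (i : Fin (n + 1)) {g : Fin (n + 1) → ℂ → ℝ}
    (hg : ∀ k, Integrable (g k)) :
    ∫ z : Fin (n + 1) → ℂ, minIndicator i z * ∏ k, g k (z k) =
      ∫ x, g i x * ∏ j, ∫ y in {y : ℂ | ‖x‖ ≤ ‖y‖}, g (i.succAbove j) y := by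
  have hint : Integrable fun z : Fin (n + 1) → ℂ => minIndicator i z * ∏ k, g k (z k) :=
    (Integrable.fintype_prod hg).bdd_mul (c := 1) (measurable_minIndicator i).aestronglyMeasurable
      (.of_forall fun z => by
        rw [Real.norm_of_nonneg (minIndicator_nonneg i z)]; exact minIndicator_le_one i z)
  have hmp := (volume_preserving_piFinSuccAbove (fun _ : Fin (n + 1) => ℂ) i).symm
  have hsplit (x : ℂ) (y : Fin n → ℂ) :
      minIndicator i (i.insertNth x y : Fin (n + 1) → ℂ) *
          ∏ k, g k ((i.insertNth x y : Fin (n + 1) → ℂ) k) =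
        g i x * ∏ j, {w : ℂ | ‖x‖ ≤ ‖w‖}.indicator (g (i.succAbove j)) (y j) := by
    rw [minIndicator_insertNth, Fin.prod_univ_succAbove _ i, mul_left_comm,
      ← Finset.prod_mul_distrib]
    simp [← Set.indicator_mul_left]
  rw [← hmp.integral_comp', Measure.volume_eq_prod, integral_prod]
  · refine integral_congr_ae (.of_forall fun x => ?_)
    refine (integral_congr_ae (.of_forall (hsplit x))).trans ?_
    rw [integral_const_mul, integral_fintype_prod_volume_eq_prod]
    simp_rw [integral_indicator (measurableSet_le measurable_const measurable_norm)]
  · exact hmp.integrable_comp_of_integrable hint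

/-- The unnormalised Gaussian density on `ℂ^ι`. -/
noncomputable def gaussWeight {ι : Type*} [Fintype ι] (z : ι → ℂ) : ℝ :=
  Real.exp (-∑ k, ‖z k‖ ^ 2)

theorem gaussWeight_pos {ι : Type*} [Fintype ι] (z : ι → ℂ) : 0 < gaussWeight z :=
  Real.exp_pos _

@[fun_prop]
theorem continuous_gaussWeight {ι : Type*} [Fintype ι] :
    Continuous (gaussWeight : (ι → ℂ) → ℝ) := by
  unfold gaussWeight
  fun_prop

theorem norm_sq_mul_gaussWeight_eq_prod {ι : Type*} [Fintype ι] [DecidableEq ι] (k : ι)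
    (z : ι → ℂ) : ‖z k‖ ^ 2 * gaussWeight z =
      ∏ j, (if j = k then ‖z j‖ ^ 2 else 1) * Real.exp (-(1 * ‖z j‖ ^ 2)) := by
  rw [Finset.prod_mul_distrib, Fintype.prod_ite_eq', ← Real.exp_sum, Finset.sum_neg_distrib]
  simp only [one_mul, gaussWeight]

theorem integral_norm_sq_mul_gaussWeight {ι : Type*} [Fintype ι] (k : ι) :
    ∫ z : ι → ℂ, ‖z k‖ ^ 2 * gaussWeight z = Real.pi ^ Fintype.card ι := by
  classical
  simp_rw [norm_sq_mul_gaussWeight_eq_prod]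
  rw [integral_fintype_prod_volume_eq_prod (𝕜 := ℝ) (E := fun _ : ι => ℂ)
    (fun j z => (if j = k then ‖z‖ ^ 2 else 1) * Real.exp (-(1 * ‖z‖ ^ 2)))]
  refine (Finset.prod_congr rfl fun j _ => ?_).trans (Finset.prod_const Real.pi)
  split_ifs
  · simpa using integral_complex_sq_mul_exp_neg_mul_sq one_pos
  · simpa using integral_complex_exp_neg_mul_sq one_pos

theorem integral_minIndicator_mul_norm_sq {n : ℕ} (i k : Fin (n + 1)) :
    ∫ z : Fin (n + 1) → ℂ, minIndicator i z * (‖z k‖ ^ 2 * gaussWeight z) =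
      Real.pi ^ (n + 1) / (n + 1) * (1 + 1 / (n + 1) - if k = i then 1 else 0) := by
  let g (j : Fin (n + 1)) (z : ℂ) : ℝ := (if j = k then ‖z‖ ^ 2 else 1) * Real.exp (-(1 * ‖z‖ ^ 2))
  have hg (j) : Integrable (g j) := by
    by_cases hj : j = k
    · simpa [g, hj] using integrable_complex_sq_mul_exp_neg_mul_sq one_pos
    · simpa [g, hj] using integrable_complex_exp_neg_mul_sq one_pos
  have htail (x : ℂ) (j) : ∫ y in {y : ℂ | ‖x‖ ≤ ‖y‖}, g j y =
      (if j = k then 1 + ‖x‖ ^ 2 else 1) * (Real.pi * Real.exp (-‖x‖ ^ 2)) := by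
    by_cases hj : j = k
    · simp only [g, if_pos hj, setIntegral_le_norm_sq_mul_exp one_pos (norm_nonneg x)]
      ring_nf
    · simp only [g, if_neg hj, one_mul (Real.exp _),
        setIntegral_le_norm_exp one_pos (norm_nonneg x)]
      ring_nf
  have hn : (0 : ℝ) < (n + 1 : ℕ) := by positivity
  have hradial (x : ℂ) : g i x * ∏ j : Fin n, ∫ y in {y : ℂ | ‖x‖ ≤ ‖y‖}, g (i.succAbove j) y =
      Real.pi ^ n * (‖x‖ ^ 2 * Real.exp (-((n + 1 : ℕ) * ‖x‖ ^ 2)) +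
        (if k = i then 0 else 1) * Real.exp (-((n + 1 : ℕ) * ‖x‖ ^ 2))) := by
    have hexp : Real.exp (-((n + 1 : ℕ) * ‖x‖ ^ 2)) =
        Real.exp (-‖x‖ ^ 2) * Real.exp (-‖x‖ ^ 2) ^ n := by
      rw [← pow_succ', ← Real.exp_nat_mul, mul_neg]
    simp_rw [htail, hexp]
    rw [Finset.prod_mul_distrib, Finset.prod_const, Finset.card_univ, Fintype.card_fin, mul_pow]
    induction k using Fin.succAboveCases i with
    | x => simp [g, Fin.succAbove_ne]; ring
    | p k => simp [g, (Fin.succAbove_ne i k).symm, Fin.succAbove_ne]; ring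
  have hprod (z : Fin (n + 1) → ℂ) : ‖z k‖ ^ 2 * gaussWeight z = ∏ j, g j (z j) :=
    norm_sq_mul_gaussWeight_eq_prod k z
  simp_rw [hprod]
  rw [integral_minIndicator_mul_prod i hg]
  simp_rw [hradial]
  rw [integral_const_mul, integral_add (integrable_complex_sq_mul_exp_neg_mul_sq hn)
    ((integrable_complex_exp_neg_mul_sq hn).const_mul _), integral_const_mul,
    integral_complex_exp_neg_mul_sq hn, integral_complex_sq_mul_exp_neg_mul_sq hn]
  split_ifs <;> push_cast <;> field_simp <;> ring

section Unitary

variable {ι : Type*} [Fintype ι]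

theorem ofReal_sum_norm_sq (z : ι → ℂ) : ((∑ k, ‖z k‖ ^ 2 : ℝ) : ℂ) = star z ⬝ᵥ z := by
  simp [dotProduct, Complex.conj_mul']

variable [DecidableEq ι] {U : Matrix ι ι ℂ}

theorem sum_norm_sq_unitary_mulVec (hU : U ∈ Matrix.unitaryGroup ι ℂ) (z : ι → ℂ) :
    ∑ k, ‖(U *ᵥ z) k‖ ^ 2 = ∑ k, ‖z k‖ ^ 2 := by
  have h : star (U *ᵥ z) ⬝ᵥ (U *ᵥ z) = star z ⬝ᵥ z := by
    rw [Matrix.star_mulVec, ← Matrix.dotProduct_mulVec, Matrix.mulVec_mulVec,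
      ← Matrix.star_eq_conjTranspose, Matrix.mem_unitaryGroup_iff'.mp hU, Matrix.one_mulVec]
  rw [← ofReal_sum_norm_sq, ← ofReal_sum_norm_sq] at h
  exact_mod_cast h

theorem gaussWeight_unitary_mulVec (hU : U ∈ Matrix.unitaryGroup ι ℂ) (z : ι → ℂ) :
    gaussWeight (U *ᵥ z) = gaussWeight z := by
  rw [gaussWeight, sum_norm_sq_unitary_mulVec hU, gaussWeight]

theorem measurePreserving_unitary_mulVec (hU : U ∈ Matrix.unitaryGroup ι ℂ) :
    MeasurePreserving (fun z : ι → ℂ => U *ᵥ z) volume volume := by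
  have hnorm : ‖U.det‖ = 1 := CStarRing.norm_of_mem_unitary (Matrix.det_of_mem_unitary hU)
  have hdet : |LinearMap.det ((Matrix.toLin' U).restrictScalars ℝ)| = 1 := by
    rw [LinearMap.det_restrictScalars, LinearMap.det_toLin', Algebra.norm_complex_apply,
      Complex.normSq_eq_norm_sq, hnorm, one_pow, abs_one]
  refine ⟨by fun_prop, ?_⟩
  have h := Measure.map_linearMap_addHaar_eq_smul_addHaar (volume : Measure (ι → ℂ))
    (f := (Matrix.toLin' U).restrictScalars ℝ) (abs_ne_zero.mp (by rw [hdet]; exact one_ne_zero))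
  rw [abs_inv, hdet, inv_one, ENNReal.ofReal_one, one_smul] at h
  exact h

theorem integral_unitary_mulVec {E : Type*} [NormedAddCommGroup E] [NormedSpace ℝ E]
    (hU : U ∈ Matrix.unitaryGroup ι ℂ) (g : (ι → ℂ) → E) : ∫ z, g (U *ᵥ z) = ∫ z, g z := by
  have hinj : Function.Injective fun z : ι → ℂ => U *ᵥ z :=
    Function.LeftInverse.injective (g := fun z => star U *ᵥ z) fun z => by
      simp only [Matrix.mulVec_mulVec, Matrix.mem_unitaryGroup_iff'.mp hU, Matrix.one_mulVec]
  exact (measurePreserving_unitary_mulVec hU).integral_comp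
    (Continuous.measurableEmbedding (by fun_prop) hinj) g

end Unitary

/-- The second moments of the Gaussian vector reweighted by `f`, i.e. the matrix
`∫ f(z) |z⟩⟨z| exp(-‖z‖²) dz`. -/
noncomputable def gaussMoment {ι : Type*} [Fintype ι] (f : (ι → ℂ) → ℝ) : Matrix ι ι ℂ :=
  entryIntegral volume fun z => (f z * gaussWeight z) • Matrix.vecMulVec z (star z)

section GaussMoment

variable {ι : Type*} [Fintype ι] {f : (ι → ℂ) → ℝ} {C : ℝ}

theorem integrable_smul_gaussWeight_vecMulVec (hf : Measurable f) (hC : ∀ z, |f z| ≤ C) (k l : ι) :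
    Integrable fun z : ι → ℂ => ((f z * gaussWeight z) • Matrix.vecMulVec z (star z)) k l := by
  have hsq (k : ι) : Integrable fun z : ι → ℂ => ‖z k‖ ^ 2 * gaussWeight z :=
    .of_integral_ne_zero (by rw [integral_norm_sq_mul_gaussWeight]; positivity)
  have hone : Integrable fun z : ι → ℂ => gaussWeight z • (z k * star (z l)) := by
    refine ((hsq k).add (hsq l)).mono' (by fun_prop) (.of_forall fun z => ?_)
    rw [norm_smul, norm_mul, norm_star, Real.norm_of_nonneg (gaussWeight_pos z).le]
    have := gaussWeight_pos z
    simp only [Pi.add_apply]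
    nlinarith [sq_nonneg (‖z k‖ - ‖z l‖), mul_nonneg (norm_nonneg (z k)) (norm_nonneg (z l))]
  refine (hone.bdd_smul C hf.aestronglyMeasurable (.of_forall hC)).congr (.of_forall fun z => ?_)
  simp [Matrix.vecMulVec_apply, mul_assoc]

theorem gaussMoment_apply_self (f : (ι → ℂ) → ℝ) (k : ι) :
    gaussMoment f k k = ((∫ z, f z * (‖z k‖ ^ 2 * gaussWeight z) : ℝ) : ℂ) := by
  rw [← integral_complex_ofReal]
  refine integral_congr_ae (.of_forall fun z => ?_)
  simp [Matrix.vecMulVec_apply, Complex.mul_conj']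
  ring

theorem gaussMoment_sum_smul {κ : Type*} (s : Finset κ) (c : κ → ℝ) {f : κ → (ι → ℂ) → ℝ}
    (hf : ∀ i ∈ s, Measurable (f i)) (hC : ∀ i ∈ s, ∀ z, |f i z| ≤ C) :
    gaussMoment (fun z => ∑ i ∈ s, c i * f i z) = ∑ i ∈ s, c i • gaussMoment (f i) := by
  simp only [gaussMoment, Finset.sum_mul, Finset.sum_smul, mul_assoc, mul_smul (c _),
    ← entryIntegral_smul]
  exact entryIntegral_sum s fun i hi k l =>
    (integrable_smul_gaussWeight_vecMulVec (hf i hi) (hC i hi) k l).smul (c i)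

theorem gaussMoment_comp_unitary [DecidableEq ι] {U : Matrix ι ι ℂ}
    (hf : Measurable f) (hC : ∀ z, |f z| ≤ C) (hU : U ∈ Matrix.unitaryGroup ι ℂ) :
    gaussMoment (fun z => f (star U *ᵥ z)) = U * gaussMoment f * star U := by
  have hconj (z : ι → ℂ) : Matrix.vecMulVec (U *ᵥ z) (star (U *ᵥ z)) =
      U * Matrix.vecMulVec z (star z) * star U := by
    rw [Matrix.mul_vecMulVec, Matrix.vecMulVec_mul, Matrix.star_mulVec,
      Matrix.star_eq_conjTranspose]
  refine Eq.trans ?_ (map_entryIntegral_matrix (LinearMap.mulLeftRight ℂ (U, star U))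
    (integrable_smul_gaussWeight_vecMulVec hf hC)).symm
  ext k l
  refine (integral_unitary_mulVec hU _).symm.trans (integral_congr_ae (.of_forall fun z => ?_))
  simp only [gaussWeight_unitary_mulVec hU, Matrix.mulVec_mulVec,
    Matrix.mem_unitaryGroup_iff'.mp hU, Matrix.one_mulVec, hconj, LinearMap.mulLeftRight_apply,
    Matrix.mul_smul, Matrix.smul_mul]

/-- Off-diagonal moments are killed by flipping the sign of one coordinate. -/
theorem gaussMoment_apply_of_ne (hf : Measurable f) (hC : ∀ z, |f z| ≤ C)
    (hmod : ∀ z w, (∀ j, ‖z j‖ = ‖w j‖) → f z = f w) {k l : ι} (hkl : k ≠ l) :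
    gaussMoment f k l = 0 := by
  classical
  let s : ι → ℂ := fun j => if j = k then -1 else 1
  have hstar : star (Matrix.diagonal s) = Matrix.diagonal s := by
    rw [Matrix.star_eq_conjTranspose, Matrix.diagonal_conjTranspose]
    congr 1
    funext j
    by_cases hj : j = k <;> simp [s, hj]
  have hU : Matrix.diagonal s ∈ Matrix.unitaryGroup ι ℂ := by
    rw [Matrix.mem_unitaryGroup_iff', hstar, Matrix.diagonal_mul_diagonal, ← Matrix.diagonal_one]
    congr 1
    funext j
    by_cases hj : j = k <;> simp [s, hj]
  have hinv : (fun z => f (star (Matrix.diagonal s) *ᵥ z)) = f := by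
    funext z
    refine hmod _ _ fun j => ?_
    by_cases hj : j = k <;> simp [hstar, Matrix.mulVec_diagonal, s, hj]
  have h := congrFun₂ (gaussMoment_comp_unitary hf hC hU) k l
  rw [hinv, hstar, Matrix.mul_diagonal, Matrix.diagonal_mul] at h
  simpa [s, hkl.symm, self_eq_neg] using h

theorem gaussMoment_one [DecidableEq ι] :
    gaussMoment (fun _ : ι → ℂ => 1) = (Real.pi ^ Fintype.card ι) • (1 : Matrix ι ι ℂ) := by
  ext k l
  rcases eq_or_ne k l with rfl | hkl
  · rw [gaussMoment_apply_self]
    simp [integral_norm_sq_mul_gaussWeight]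
  · rw [gaussMoment_apply_of_ne (C := 1) measurable_const (by simp) (fun _ _ _ => rfl) hkl]
    simp [hkl]

end GaussMoment

theorem gaussMoment_minIndicator {d : ℕ} (i : Fin d) :
    gaussMoment (minIndicator i) = (Real.pi ^ d / d) •
      ((1 + 1 / (d : ℝ)) • (1 : Matrix (Fin d) (Fin d) ℂ) - Matrix.single i i 1) := by
  obtain ⟨n, rfl⟩ : ∃ n, d = n + 1 := Nat.exists_eq_succ_of_ne_zero (Fin.pos i).ne'
  ext k l
  rcases eq_or_ne k l with rfl | hkl
  · rw [gaussMoment_apply_self, integral_minIndicator_mul_norm_sq]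
    rcases eq_or_ne k i with rfl | hki
    · simp
    · simp [hki, hki.symm, mul_add]
  · rw [gaussMoment_apply_of_ne (C := 1) (measurable_minIndicator i)
      (fun z => by rw [abs_of_nonneg (minIndicator_nonneg i z)]; exact minIndicator_le_one i z)
      (fun _ _ h => minIndicator_congr i h) hkl]
    have hsingle : Matrix.single i i (1 : ℂ) k l = 0 :=
      Matrix.single_apply_of_ne _ _ _ _ _ fun h => hkl (h.1.symm.trans h.2)
    simp [hkl, hsingle]

/-! ### Werner's hidden states -/

section HiddenState

variable (ι : Type*) [Fintype ι]

/-- The distribution of the hidden variable of Werner's model. The Gaussian is size-biased, so that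
the normalisation of the pure state along `z` cancels and leaves Gaussian moments. -/
noncomputable def hiddenMeasure : Measure (ι → ℂ) :=
  volume.withDensity fun z => ENNReal.ofReal
    (1 / (Fintype.card ι * Real.pi ^ Fintype.card ι) * ((∑ k, ‖z k‖ ^ 2) * gaussWeight z))

theorem isProbabilityMeasure_hiddenMeasure [Nonempty ι] :
    IsProbabilityMeasure (hiddenMeasure ι) := by
  have hint : ∫ z : ι → ℂ, 1 / (Fintype.card ι * Real.pi ^ Fintype.card ι) *
      ((∑ k, ‖z k‖ ^ 2) * gaussWeight z) = 1 := by
    simp_rw [integral_const_mul, Finset.sum_mul]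
    rw [integral_finsetSum _ fun k _ => .of_integral_ne_zero
      (by rw [integral_norm_sq_mul_gaussWeight]; positivity)]
    simp only [integral_norm_sq_mul_gaussWeight, Finset.sum_const, Finset.card_univ, nsmul_eq_mul]
    field_simp
  refine ⟨?_⟩
  rw [hiddenMeasure, withDensity_apply _ MeasurableSet.univ, Measure.restrict_univ,
    ← ofReal_integral_eq_lintegral_ofReal (.of_integral_ne_zero (hint.trans_ne one_ne_zero)), hint,
    ENNReal.ofReal_one]
  exact .of_forall fun z => by have := gaussWeight_pos z; positivity

variable {ι} [DecidableEq ι]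

/-- The pure state along `z`; the value at `z = 0`, a null set, is an arbitrary state. -/
noncomputable def hiddenState (z : ι → ℂ) : Matrix ι ι ℂ :=
  open Classical in
  if z = 0 then (1 / (Fintype.card ι : ℝ)) • 1
  else (1 / ∑ k, ‖z k‖ ^ 2) • Matrix.vecMulVec z (star z)

theorem measurable_hiddenState (k l : ι) : Measurable fun z : ι → ℂ => hiddenState z k l := by
  have hentry : (fun z : ι → ℂ => hiddenState z k l) = fun z => open Classical in
      if z = 0 then ((1 / (Fintype.card ι : ℝ)) • (1 : Matrix ι ι ℂ)) k l
      else (1 / ∑ k, ‖z k‖ ^ 2) • (z k * star (z l)) := by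
    funext z
    unfold hiddenState
    split_ifs <;> rfl
  rw [hentry]
  exact Measurable.ite (measurableSet_singleton 0) measurable_const (by fun_prop)

theorem isDensity_hiddenState [Nonempty ι] (z : ι → ℂ) : IsDensity (hiddenState z) := by
  unfold hiddenState
  split_ifs with h
  · exact ⟨Matrix.PosSemidef.one.smul (by positivity), by simp [Matrix.trace_smul]⟩
  · have hz : star z ⬝ᵥ z ≠ 0 := by simpa using h
    refine ⟨(Matrix.posSemidef_vecMulVec_self_star z).smul (by positivity), ?_⟩
    rw [Matrix.trace_smul, Matrix.trace_vecMulVec, dotProduct_comm, ← ofReal_sum_norm_sq,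
      Complex.real_smul, ← Complex.ofReal_mul, one_div_mul_cancel, Complex.ofReal_one]
    rwa [← ofReal_sum_norm_sq, Complex.ofReal_ne_zero] at hz

theorem entryIntegral_smul_hiddenState (f : (ι → ℂ) → ℝ) :
    entryIntegral (hiddenMeasure ι) (fun z => f z • hiddenState z) =
      (1 / (Fintype.card ι * Real.pi ^ Fintype.card ι) : ℝ) • gaussMoment f := by
  rw [gaussMoment, ← entryIntegral_smul]
  ext k l
  simp only [entryIntegral, Matrix.of_apply, hiddenMeasure]
  rw [integral_withDensity_eq_integral_toReal_smul (by fun_prop)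
    (.of_forall fun z => ENNReal.ofReal_lt_top)]
  refine integral_congr_ae (.of_forall fun z => ?_)
  have := gaussWeight_pos z
  simp only [ENNReal.toReal_ofReal (show 0 ≤ 1 / (Fintype.card ι * Real.pi ^ Fintype.card ι) *
    ((∑ k, ‖z k‖ ^ 2) * gaussWeight z) by positivity), ← Matrix.smul_apply, smul_smul]
  rw [hiddenState]
  split_ifs with h
  · simp [h]
  · have hz : ∑ k, ‖z k‖ ^ 2 ≠ 0 := by
      rw [← Complex.ofReal_ne_zero, ofReal_sum_norm_sq]
      simpa using h
    rw [smul_smul]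
    field_simp

theorem entryIntegral_hiddenState :
    entryIntegral (hiddenMeasure ι) hiddenState =
      (1 / (Fintype.card ι : ℝ)) • (1 : Matrix ι ι ℂ) := by
  have h := entryIntegral_smul_hiddenState fun _ : ι → ℂ => 1
  simp only [one_smul, gaussMoment_one, smul_smul] at h
  rw [h]
  congr 1
  field_simp

end HiddenState

theorem sum_eigenvalues_smul_single {ι : Type*} [Fintype ι] [DecidableEq ι] {N : Matrix ι ι ℂ}
    (hN : N.IsHermitian) :
    ∑ i, hN.eigenvalues i • ((hN.eigenvectorUnitary : Matrix ι ι ℂ) * Matrix.single i i 1 *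
      star (hN.eigenvectorUnitary : Matrix ι ι ℂ)) = N := by
  conv_rhs => rw [hN.spectral_theorem, Unitary.conjStarAlgAut_apply]
  have hdiag : Matrix.diagonal (RCLike.ofReal ∘ hN.eigenvalues : ι → ℂ) =
      ∑ i, hN.eigenvalues i • Matrix.single i i 1 := by
    simp [← Matrix.sum_single_eq_diagonal, Matrix.smul_single]
  simp only [hdiag, Finset.mul_sum, Finset.sum_mul, Matrix.mul_smul, Matrix.smul_mul]

/-- Werner's response to the effect `N = ∑ᵢ ηᵢ |uᵢ⟩⟨uᵢ|`: the outcome `uᵢ` is announced on the cone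
where the component of `z` along `uᵢ` is the smallest. -/
theorem exists_response_hiddenState {d : ℕ} {N : Matrix (Fin d) (Fin d) ℂ} (hN : N.PosSemidef) :
    ∃ R : (Fin d → ℂ) → ℝ, Measurable R ∧ (∀ z, 0 ≤ R z) ∧ (∀ z, R z ≤ N.trace.re) ∧
      entryIntegral (hiddenMeasure (Fin d)) (fun z => R z • hiddenState z) =
        (1 / (d : ℝ) ^ 2) • (((1 + 1 / (d : ℝ)) * N.trace.re) • 1 - N) := by
  obtain ⟨U, hU, η, hη0, hspec⟩ : ∃ U ∈ Matrix.unitaryGroup (Fin d) ℂ, ∃ η : Fin d → ℝ,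
      (∀ i, 0 ≤ η i) ∧ ∑ i, η i • (U * Matrix.single i i 1 * star U) = N :=
    ⟨_, hN.isHermitian.eigenvectorUnitary.2, _, hN.eigenvalues_nonneg,
      sum_eigenvalues_smul_single hN.isHermitian⟩
  have htrace : N.trace.re = ∑ i, η i := by
    simp [← hspec, Matrix.trace_sum, Matrix.trace_smul, Matrix.trace_mul_cycle,
      Matrix.mem_unitaryGroup_iff'.mp hU]
  have hmeas (i) : Measurable fun z : Fin d → ℂ => minIndicator i (star U *ᵥ z) :=
    (measurable_minIndicator i).comp (by fun_prop)
  have hbound (i) (z : Fin d → ℂ) : |minIndicator i z| ≤ 1 := by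
    rw [abs_of_nonneg (minIndicator_nonneg i z)]
    exact minIndicator_le_one i z
  refine ⟨fun z => ∑ i, η i * minIndicator i (star U *ᵥ z), by fun_prop,
    fun z => Finset.sum_nonneg fun i _ => mul_nonneg (hη0 i) (minIndicator_nonneg _ _),
    fun z => htrace ▸ Finset.sum_le_sum fun i _ =>
      mul_le_of_le_one_right (hη0 i) (minIndicator_le_one _ _), ?_⟩
  have hmoment (i) : gaussMoment (fun z => minIndicator i (star U *ᵥ z)) = (Real.pi ^ d / d) •
      ((1 + 1 / (d : ℝ)) • 1 - U * Matrix.single i i 1 * star U) := by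
    rw [gaussMoment_comp_unitary (measurable_minIndicator i) (hbound i) hU,
      gaussMoment_minIndicator, Matrix.mul_smul, Matrix.smul_mul, Matrix.mul_sub, Matrix.sub_mul,
      Matrix.mul_smul, Matrix.smul_mul, Matrix.mul_one, Matrix.mem_unitaryGroup_iff.mp hU]
  rw [entryIntegral_smul_hiddenState, gaussMoment_sum_smul _ _ (fun i _ => hmeas i)
    (fun i _ z => hbound i _), htrace]
  simp_rw [hmoment, smul_comm (η _), smul_sub (η _), smul_smul]
  rw [← Finset.smul_sum, Finset.sum_sub_distrib, hspec, ← Finset.sum_smul, ← Finset.sum_mul]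
  rw [smul_smul, show 1 / (Fintype.card (Fin d) * Real.pi ^ Fintype.card (Fin d)) *
    (Real.pi ^ d / d) = 1 / (d : ℝ) ^ 2 by rw [Fintype.card_fin]; field_simp, mul_comm (1 + _)]

/-! ### Partial traces -/

section PartialTrace

variable {m n m' n' : Type*}

theorem kronecker_induction [Finite m] [Finite n] {motive : Matrix (m × n) (m × n) ℂ → Prop}
    (kronecker : ∀ A B, motive (A ⊗ₖ B)) (add : ∀ ω ω', motive ω → motive ω' → motive (ω + ω'))
    (ω : Matrix (m × n) (m × n) ℂ) : motive ω := by
  classical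
  refine Matrix.induction_on' ω ?_ add fun i j c => ?_
  · simpa using kronecker 0 0
  · simpa [Matrix.single_kronecker_single] using
      kronecker (Matrix.single i.1 j.1 c) (Matrix.single i.2 j.2 1)

theorem exchange_add (ω ω' : Matrix (m × n) (m × n) ℂ) :
    exchange (ω + ω') = exchange ω + exchange ω' := rfl

theorem exchange_sub (ω ω' : Matrix (m × n) (m × n) ℂ) :
    exchange (ω - ω') = exchange ω - exchange ω' := rfl

theorem exchange_smul {R : Type*} [SMul R ℂ] (c : R) (ω : Matrix (m × n) (m × n) ℂ) :
    exchange (c • ω) = c • exchange ω := rfl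

theorem exchange_exchange (ω : Matrix (m × n) (m × n) ℂ) : exchange (exchange ω) = ω := rfl

theorem exchange_kronecker (A : Matrix m m ℂ) (B : Matrix n n ℂ) :
    exchange (A ⊗ₖ B) = B ⊗ₖ A := by
  ext i j
  exact mul_comm _ _

theorem exchange_kronecker_mul_mul_kronecker [Fintype m] [Fintype n] (A : Matrix m' m ℂ)
    (B : Matrix n' n ℂ) (A' : Matrix m m' ℂ) (B' : Matrix n n' ℂ) (ω : Matrix (m × n) (m × n) ℂ) :
    exchange ((A ⊗ₖ B) * ω * (A' ⊗ₖ B')) = (B ⊗ₖ A) * exchange ω * (B' ⊗ₖ A') := by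
  induction ω using kronecker_induction with
  | kronecker C D => simp only [exchange_kronecker, ← Matrix.mul_kronecker_mul]
  | add ω ω' h h' => simp only [Matrix.mul_add, Matrix.add_mul, exchange_add, h, h']

theorem posSemidef_exchange {ω : Matrix (m × n) (m × n) ℂ} (hω : ω.PosSemidef) :
    (exchange ω).PosSemidef :=
  hω.submatrix _

variable [Fintype m]

theorem ptraceA_add (ω ω' : Matrix (m × n) (m × n) ℂ) :
    ptraceA (ω + ω') = ptraceA ω + ptraceA ω' := by
  ext
  simp [ptraceA, Finset.sum_add_distrib]

theorem ptraceA_sub (ω ω' : Matrix (m × n) (m × n) ℂ) :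
    ptraceA (ω - ω') = ptraceA ω - ptraceA ω' := by
  ext
  simp [ptraceA, Finset.sum_sub_distrib]

theorem ptraceA_smul {R : Type*} [DistribSMul R ℂ] (c : R) (ω : Matrix (m × n) (m × n) ℂ) :
    ptraceA (c • ω) = c • ptraceA ω := by
  ext
  simp [ptraceA, Finset.smul_sum]

theorem ptraceA_kronecker (A : Matrix m m ℂ) (B : Matrix n n ℂ) :
    ptraceA (A ⊗ₖ B) = A.trace • B := by
  ext
  simp [ptraceA, Matrix.trace, Finset.sum_mul]

theorem posSemidef_ptraceA {ω : Matrix (m × n) (m × n) ℂ} (hω : ω.PosSemidef) :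
    (ptraceA ω).PosSemidef := by
  have hsum : ptraceA ω = ∑ k, ω.submatrix (Prod.mk k) (Prod.mk k) := by
    ext
    simp [ptraceA, Matrix.sum_apply]
  exact hsum ▸ Matrix.posSemidef_sum _ fun k _ => hω.submatrix _

variable [Fintype n]

theorem ptraceA_kronecker_mul_mul_kronecker [Fintype m'] [DecidableEq n] (A : Matrix m' m ℂ)
    (B : Matrix n' n ℂ) (A' : Matrix m m' ℂ) (B' : Matrix n n' ℂ) (ω : Matrix (m × n) (m × n) ℂ) :
    ptraceA ((A ⊗ₖ B) * ω * (A' ⊗ₖ B')) =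
      B * ptraceA (((A' * A) ⊗ₖ (1 : Matrix n n ℂ)) * ω) * B' := by
  induction ω using kronecker_induction with
  | kronecker C D =>
    simp only [← Matrix.mul_kronecker_mul, ptraceA_kronecker, Matrix.one_mul, Matrix.mul_smul,
      Matrix.smul_mul, Matrix.trace_mul_cycle A C A']
  | add ω ω' h h' => simp only [Matrix.mul_add, Matrix.add_mul, ptraceA_add, h, h']

theorem ptraceA_kronecker_one_mul_conj [Fintype m'] [Fintype n'] [DecidableEq n] [DecidableEq n']
    (V : Matrix m' m ℂ) (W : Matrix n' n ℂ) (N : Matrix m' m' ℂ) (ω : Matrix (m × n) (m × n) ℂ) :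
    ptraceA ((N ⊗ₖ (1 : Matrix n' n' ℂ)) * ((V ⊗ₖ W) * ω * (V ⊗ₖ W)ᴴ)) =
      W * ptraceA (((Vᴴ * N * V) ⊗ₖ (1 : Matrix n n ℂ)) * ω) * Wᴴ := by
  rw [← Matrix.mul_assoc, ← Matrix.mul_assoc, ← Matrix.mul_kronecker_mul, Matrix.one_mul,
    Matrix.conjTranspose_kronecker, ptraceA_kronecker_mul_mul_kronecker, Matrix.mul_assoc Vᴴ]

theorem ptraceA_kronecker_one_mul_kronecker [DecidableEq n] (N A : Matrix m m ℂ)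
    (B : Matrix n n ℂ) :
    ptraceA ((N ⊗ₖ (1 : Matrix n n ℂ)) * (A ⊗ₖ B)) = (N * A).trace • B := by
  rw [← Matrix.mul_kronecker_mul, Matrix.one_mul, ptraceA_kronecker]

theorem trace_ptraceA (ω : Matrix (m × n) (m × n) ℂ) : (ptraceA ω).trace = ω.trace :=
  (Fintype.sum_prod_type_right fun i => ω i i).symm

theorem trace_ptraceA_kronecker_one_mul [DecidableEq n] (N : Matrix m m ℂ)
    (ω : Matrix (m × n) (m × n) ℂ) :
    (ptraceA ((N ⊗ₖ (1 : Matrix n n ℂ)) * ω)).trace = (N * ptraceA (exchange ω)).trace := by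
  induction ω using kronecker_induction with
  | kronecker C D =>
    simp [ptraceA_kronecker_one_mul_kronecker, exchange_kronecker, ptraceA_kronecker, mul_comm]
  | add ω ω' h h' => simp only [Matrix.mul_add, ptraceA_add, exchange_add, Matrix.trace_add, h, h']

theorem trace_exchange (ω : Matrix (m × n) (m × n) ℂ) : (exchange ω).trace = ω.trace :=
  (Equiv.prodComm n m).sum_comp fun i => ω i i

theorem IsDensity.exchange {ρ : Matrix (m × n) (m × n) ℂ} (hρ : IsDensity ρ) :
    IsDensity (exchange ρ) :=
  ⟨posSemidef_exchange hρ.1, (trace_exchange ρ).trans hρ.2⟩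

end PartialTrace

/-! ### Local-hidden-state decompositions -/

section LHS

theorem IsDensity.norm_apply_le_one {n : Type*} [Fintype n] {τ : Matrix n n ℂ} (hτ : IsDensity τ)
    (i j : n) : ‖τ i j‖ ≤ 1 := by
  have hdiag (k : n) : τ k k ≤ 1 := by
    rw [← hτ.2]
    exact Finset.single_le_sum (f := τ.diag) (fun _ _ => hτ.1.diag_nonneg) (Finset.mem_univ k)
  have hminor : τ i j * τ j i ≤ τ i i * τ j j := by
    have := (hτ.1.submatrix ![i, j]).det_nonneg
    rwa [Matrix.det_fin_two, sub_nonneg] at this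
  rw [← hτ.1.isHermitian.apply j i, Complex.star_def, Complex.mul_conj'] at hminor
  have hsq : ((‖τ i j‖ ^ 2 : ℝ) : ℂ) ≤ 1 := by
    push_cast
    exact hminor.trans (mul_le_one₀ (hdiag i) hτ.1.diag_nonneg (hdiag j))
  exact (sq_le_one_iff₀ (norm_nonneg _)).mp (by exact_mod_cast hsq)

variable {Λ n : Type*} [MeasurableSpace Λ] {μ : Measure Λ} {τ : Λ → Matrix n n ℂ}

theorem entryIntegral_smul_eq_iff {p : Λ → ℝ} {σ : Matrix n n ℂ} :
    entryIntegral μ (fun l => p l • τ l) = σ ↔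
      ∀ i j, σ i j = ∫ l, (p l : ℂ) * τ l i j ∂μ := by
  simp only [← Matrix.ext_iff, entryIntegral, Matrix.of_apply, Matrix.smul_apply,
    Complex.real_smul, eq_comm]

variable [Fintype n] [IsFiniteMeasure μ]

theorem integrable_density_apply (hτ_meas : ∀ i j, Measurable fun l => τ l i j)
    (hτ : ∀ l, IsDensity (τ l)) (i j : n) : Integrable (fun l => τ l i j) μ :=
  .of_bound (hτ_meas i j).aestronglyMeasurable 1 (.of_forall fun l => (hτ l).norm_apply_le_one i j)

theorem integrable_smul_density_apply {p : Λ → ℝ} {C : ℝ} (hp : Measurable p)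
    (hp0 : ∀ l, 0 ≤ p l) (hpC : ∀ l, p l ≤ C) (hτ_meas : ∀ i j, Measurable fun l => τ l i j)
    (hτ : ∀ l, IsDensity (τ l)) (i j : n) : Integrable (fun l => (p l • τ l) i j) μ :=
  (integrable_density_apply hτ_meas hτ i j).bdd_smul C hp.aestronglyMeasurable
    (.of_forall fun l => by rw [Real.norm_of_nonneg (hp0 l)]; exact hpC l)

end LHS

theorem apply_le_one_of_sum_eq_one {ι : Type*} [Fintype ι] {q : ι → ℝ} (hq0 : ∀ a, 0 ≤ q a)
    (hq1 : ∑ a, q a = 1) (a : ι) : q a ≤ 1 :=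
  hq1 ▸ Finset.single_le_sum (fun b _ => hq0 b) (Finset.mem_univ a)

theorem HasLHSDecomposition.map {n n' : Type*} [Fintype n] [Fintype n'] {X : Type} {k : X → ℕ}
    {σ : ∀ x, Fin (k x) → Matrix n n ℂ} (hσ : HasLHSDecomposition σ)
    (Φ : Matrix n n ℂ →ₗ[ℂ] Matrix n' n' ℂ) (hΦ : ∀ τ, IsDensity τ → IsDensity (Φ τ)) :
    HasLHSDecomposition fun x a => Φ (σ x a) := by
  obtain ⟨Λ, _, μ, p, τ, hμ, hp, hp0, hp1, hτ_meas, hτ, hσ⟩ := hσ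
  refine ⟨Λ, _, μ, p, fun l => Φ (τ l), hμ, hp, hp0, hp1, fun i j => ?_,
    fun l => hΦ _ (hτ l), fun x a => entryIntegral_smul_eq_iff.mp ?_⟩
  · exact measurable_map_of_measurable_apply (Matrix.entryLinearMap ℂ ℂ i j ∘ₗ Φ) hτ_meas
  have hple (l : Λ) : p x a l ≤ 1 := apply_le_one_of_sum_eq_one (hp0 x · l) (hp1 x l) a
  simp only
  rw [← entryIntegral_smul_eq_iff.mpr (hσ x a), map_entryIntegral_matrix Φ
    (integrable_smul_density_apply (hp x a) (hp0 x a) hple hτ_meas hτ)]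
  simp_rw [LinearMap.map_smul_of_tower]

/-! ### Flag extensions -/

section Flag

theorem isDensity_single {n : Type*} [Fintype n] [DecidableEq n] (i : n) :
    IsDensity (Matrix.single i i (1 : ℂ)) := by
  refine ⟨?_, Matrix.trace_single_eq_same _ _⟩
  rw [← Matrix.diagonal_single]
  exact .diagonal (Pi.single_nonneg.mpr zero_le_one)

variable {m n : Type*} [Fintype m] [DecidableEq m] [Fintype n] [DecidableEq n]

theorem conjTranspose_incl_mul_incl : (incl m)ᴴ * incl m = 1 := by
  simp [incl, Matrix.conjTranspose_fromRows_eq_fromCols_conjTranspose, Matrix.fromCols_mul_fromRows]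

theorem conjTranspose_incl_mul_flagProj : (incl m)ᴴ * flagProj m = 0 := by
  ext i j
  simp [incl, flagProj, Matrix.mul_apply, Matrix.single_apply]

theorem isDensity_flagProj : IsDensity (flagProj m) :=
  isDensity_single _

theorem posSemidef_flagA {ρ : Matrix (m × n) (m × n) ℂ} (hρ : ρ.PosSemidef) :
    (flagA ρ).PosSemidef :=
  ((hρ.mul_mul_conjTranspose_same _).add
    ((isDensity_flagProj.1.kronecker (posSemidef_ptraceA hρ)).smul (by positivity))).smul
    (by positivity)

theorem trace_flagA (ρ : Matrix (m × n) (m × n) ℂ) : (flagA ρ).trace = ρ.trace := by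
  have hm : (Fintype.card m + 1 : ℝ) ≠ 0 := by positivity
  rw [flagA, Matrix.trace_smul, Matrix.trace_add, Matrix.trace_smul, Matrix.trace_kronecker,
    isDensity_flagProj.2, trace_ptraceA, Matrix.trace_mul_cycle, Matrix.conjTranspose_kronecker,
    ← Matrix.mul_kronecker_mul, conjTranspose_incl_mul_incl, Matrix.conjTranspose_one,
    Matrix.one_mul, Matrix.one_kronecker_one, Matrix.one_mul, one_mul]
  match_scalars
  field_simp
  ring

theorem IsDensity.flagA {ρ : Matrix (m × n) (m × n) ℂ} (hρ : IsDensity ρ) :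
    IsDensity (flagA ρ) :=
  ⟨posSemidef_flagA hρ.1, (trace_flagA ρ).trans hρ.2⟩

theorem IsDensity.flagB {ρ : Matrix (m × n) (m × n) ℂ} (hρ : IsDensity ρ) :
    IsDensity (flagB ρ) :=
  hρ.exchange.flagA.exchange

theorem flagB_eq (ρ : Matrix (m × n) (m × n) ℂ) :
    flagB ρ = (1 / ((Fintype.card n : ℝ) + 1)) •
      (((1 : Matrix m m ℂ) ⊗ₖ incl n) * ρ * ((1 : Matrix m m ℂ) ⊗ₖ incl n)ᴴ +
        (Fintype.card n : ℝ) • (ptraceA (exchange ρ) ⊗ₖ flagProj n)) := by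
  simp only [flagB, flagA, exchange_smul, exchange_add, exchange_kronecker,
    Matrix.conjTranspose_kronecker, exchange_kronecker_mul_mul_kronecker, exchange_exchange]

theorem ptraceA_kronecker_one_mul_flagA (N : Matrix (m ⊕ Unit) (m ⊕ Unit) ℂ)
    (ρ : Matrix (m × n) (m × n) ℂ) :
    ptraceA ((N ⊗ₖ (1 : Matrix n n ℂ)) * flagA ρ) = (1 / ((Fintype.card m : ℝ) + 1)) •
      (ptraceA ((((incl m)ᴴ * N * incl m) ⊗ₖ (1 : Matrix n n ℂ)) * ρ) +
        (Fintype.card m : ℝ) • (N (.inr ()) (.inr ()) • ptraceA ρ)) := by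
  rw [flagA, Matrix.mul_smul, ptraceA_smul, Matrix.mul_add, ptraceA_add, Matrix.mul_smul,
    ptraceA_smul, ptraceA_kronecker_one_mul_conj, ptraceA_kronecker_one_mul_kronecker]
  simp [flagProj, Matrix.trace_mul_single]

theorem ptraceA_kronecker_one_mul_flagB (N : Matrix m m ℂ) (ρ : Matrix (m × n) (m × n) ℂ) :
    ptraceA ((N ⊗ₖ (1 : Matrix (n ⊕ Unit) (n ⊕ Unit) ℂ)) * flagB ρ) =
      (1 / ((Fintype.card n : ℝ) + 1)) •
        (incl n * ptraceA ((N ⊗ₖ (1 : Matrix n n ℂ)) * ρ) * (incl n)ᴴ +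
          (Fintype.card n : ℝ) •
            ((ptraceA ((N ⊗ₖ (1 : Matrix n n ℂ)) * ρ)).trace • flagProj n)) := by
  rw [flagB_eq, Matrix.mul_smul, ptraceA_smul, Matrix.mul_add, ptraceA_add, Matrix.mul_smul,
    ptraceA_smul, ptraceA_kronecker_one_mul_conj, ptraceA_kronecker_one_mul_kronecker,
    trace_ptraceA_kronecker_one_mul]
  simp

theorem ptraceA_exchange_flagA (ρ : Matrix (m × n) (m × n) ℂ) :
    ptraceA (exchange (flagA ρ)) = (1 / ((Fintype.card m : ℝ) + 1)) •
      (incl m * ptraceA (exchange ρ) * (incl m)ᴴ +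
        (Fintype.card m : ℝ) • (ρ.trace • flagProj m)) := by
  have := ptraceA_kronecker_one_mul_flagB 1 (exchange ρ)
  rwa [Matrix.one_kronecker_one, Matrix.one_mul, Matrix.one_kronecker_one, Matrix.one_mul,
    trace_ptraceA, trace_exchange] at this

theorem flagB_flagA (ρ : Matrix (m × n) (m × n) ℂ) :
    flagB (flagA ρ) = (1 / (((Fintype.card m : ℝ) + 1) * ((Fintype.card n : ℝ) + 1))) •
      ((incl m ⊗ₖ incl n) * ρ * (incl m ⊗ₖ incl n)ᴴ +
        ((Fintype.card m : ℝ) • (flagProj m ⊗ₖ (incl n * ptraceA ρ * (incl n)ᴴ)) +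
          (Fintype.card n : ℝ) • ((incl m * ptraceA (exchange ρ) * (incl m)ᴴ) ⊗ₖ flagProj n)) +
        ((Fintype.card m : ℝ) * Fintype.card n) • (ρ.trace • (flagProj m ⊗ₖ flagProj n))) := by
  have hincl : ((1 : Matrix (m ⊕ Unit) (m ⊕ Unit) ℂ) ⊗ₖ incl n) *
      ((incl m ⊗ₖ (1 : Matrix n n ℂ)) * ρ * (incl m ⊗ₖ (1 : Matrix n n ℂ))ᴴ) *
        ((1 : Matrix (m ⊕ Unit) (m ⊕ Unit) ℂ) ⊗ₖ incl n)ᴴ =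
      (incl m ⊗ₖ incl n) * ρ * (incl m ⊗ₖ incl n)ᴴ := by
    simp only [Matrix.conjTranspose_kronecker, Matrix.mul_assoc, ← Matrix.mul_kronecker_mul]
    simp only [← Matrix.mul_assoc, ← Matrix.mul_kronecker_mul, Matrix.conjTranspose_one,
      Matrix.one_mul, Matrix.mul_one]
  have hflag : ((1 : Matrix (m ⊕ Unit) (m ⊕ Unit) ℂ) ⊗ₖ incl n) * (flagProj m ⊗ₖ ptraceA ρ) *
        ((1 : Matrix (m ⊕ Unit) (m ⊕ Unit) ℂ) ⊗ₖ incl n)ᴴ =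
      flagProj m ⊗ₖ (incl n * ptraceA ρ * (incl n)ᴴ) := by
    simp only [Matrix.conjTranspose_kronecker, ← Matrix.mul_kronecker_mul,
      Matrix.conjTranspose_one, Matrix.one_mul, Matrix.mul_one]
  rw [flagB_eq, ptraceA_exchange_flagA, flagA, Matrix.mul_smul, Matrix.smul_mul, Matrix.mul_add,
    Matrix.add_mul, hincl, Matrix.mul_smul, Matrix.smul_mul, hflag, Matrix.smul_kronecker,
    Matrix.add_kronecker, Matrix.smul_kronecker, Matrix.smul_kronecker, ← one_div_mul_one_div]
  module

theorem conjTranspose_incl_mul_flagB_flagA_mul_incl (ρ : Matrix (m × n) (m × n) ℂ) :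
    (incl m ⊗ₖ incl n)ᴴ * flagB (flagA ρ) * (incl m ⊗ₖ incl n) =
      (1 / (((Fintype.card m : ℝ) + 1) * ((Fintype.card n : ℝ) + 1))) • ρ := by
  have hincl : (incl m ⊗ₖ incl n)ᴴ * (incl m ⊗ₖ incl n) = 1 := by
    rw [Matrix.conjTranspose_kronecker, ← Matrix.mul_kronecker_mul, conjTranspose_incl_mul_incl,
      conjTranspose_incl_mul_incl, Matrix.one_kronecker_one]
  have hflagA (B : Matrix (n ⊕ Unit) (n ⊕ Unit) ℂ) :
      (incl m ⊗ₖ incl n)ᴴ * (flagProj m ⊗ₖ B) = 0 := by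
    rw [Matrix.conjTranspose_kronecker, ← Matrix.mul_kronecker_mul,
      conjTranspose_incl_mul_flagProj, Matrix.zero_kronecker]
  have hflagB (A : Matrix (m ⊕ Unit) (m ⊕ Unit) ℂ) :
      (incl m ⊗ₖ incl n)ᴴ * (A ⊗ₖ flagProj n) = 0 := by
    rw [Matrix.conjTranspose_kronecker, ← Matrix.mul_kronecker_mul,
      conjTranspose_incl_mul_flagProj, Matrix.kronecker_zero]
  have hρ : (incl m ⊗ₖ incl n)ᴴ * ((incl m ⊗ₖ incl n) * ρ * (incl m ⊗ₖ incl n)ᴴ) =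
      ρ * (incl m ⊗ₖ incl n)ᴴ := by
    rw [Matrix.mul_assoc, ← Matrix.mul_assoc, hincl, Matrix.one_mul]
  simp only [flagB_flagA, Matrix.mul_smul, Matrix.mul_add, hρ, hflagA, hflagB, smul_zero, add_zero,
    Matrix.smul_mul]
  rw [Matrix.mul_assoc, hincl, Matrix.mul_one]

end Flag

theorem entryIntegral_flagResponse {Λ n α : Type*} [MeasurableSpace Λ] [Fintype α] {μ : Measure Λ}
    {τ : Λ → Matrix n n ℂ} {ω : Matrix n n ℂ} {R : α → Λ → ℝ}
    (hτ : ∀ i j, Integrable (fun l => τ l i j) μ) (hω : entryIntegral μ τ = ω)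
    (hR : ∀ a i j, Integrable (fun l => (R a l • τ l) i j) μ)
    (hR_sum : ∑ b, entryIntegral μ (fun l => R b l • τ l) = ω) (q D : ℝ) (a : α) :
    entryIntegral μ (fun l => (1 / (D + 1) * (R a l + q * (D + 1 - ∑ b, R b l))) • τ l) =
      (1 / (D + 1)) • (entryIntegral μ (fun l => R a l • τ l) + D • (q • ω)) := by
  have hexpand (l : Λ) : (1 / (D + 1) * (R a l + q * (D + 1 - ∑ b, R b l))) • τ l =
      (1 / (D + 1)) • (R a l • τ l + ((q * (D + 1)) • τ l + -q • ∑ b, R b l • τ l)) := by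
    rw [← Finset.sum_smul]
    module
  have hτ' (i j) : Integrable (fun l => ((q * (D + 1)) • τ l) i j) μ := (hτ i j).smul (q * (D + 1))
  have hsum (i j) : Integrable (fun l => (-q • ∑ b, R b l • τ l) i j) μ := by
    simp only [Matrix.smul_apply, Matrix.sum_apply]
    exact (integrable_finsetSum _ fun b _ => hR b i j).smul (-q)
  have hsum' (i j) : Integrable (fun l => ((q * (D + 1)) • τ l + -q • ∑ b, R b l • τ l) i j) μ :=
    (hτ' i j).add (hsum i j)
  simp_rw [hexpand]
  rw [entryIntegral_smul, entryIntegral_add (hR a) hsum', entryIntegral_add hτ' hsum,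
    entryIntegral_smul, entryIntegral_smul, entryIntegral_sum _ fun b _ => hR b, hR_sum, hω]
  module

section TraceBounded

variable {m n : Type*} [Fintype m] [DecidableEq m] [Fintype n] [DecidableEq n]

/-- The POVM obtained by first embedding `ℂ^m` isometrically into `ℂ^m'`. -/
def POVM.compress {k : ℕ} {m' : Type*} [Fintype m'] [DecidableEq m'] (M : POVM k m')
    (V : Matrix m' m ℂ) (hV : Vᴴ * V = 1) : POVM k m where
  elem a := Vᴴ * M.elem a * V
  posSemidef a := (M.posSemidef a).conjTranspose_mul_mul_same V
  sum_eq_one := by rw [← Matrix.sum_mul, ← Matrix.mul_sum, M.sum_eq_one, Matrix.mul_one, hV]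

theorem POVM.sum_re_apply_self {k : ℕ} (M : POVM k m) (i : m) : ∑ a, (M.elem a i i).re = 1 := by
  rw [← Complex.re_sum, ← Matrix.sum_apply, M.sum_eq_one, Matrix.one_apply_eq, Complex.one_re]

theorem POVM.sum_re_trace {k : ℕ} (M : POVM k m) : ∑ a, (M.elem a).trace.re = Fintype.card m := by
  rw [← Complex.re_sum, ← Matrix.trace_sum, M.sum_eq_one, Matrix.trace_one, Complex.natCast_re]

/-- Hidden states `τ`, distributed according to `μ`, that average to Bob's reduced state and for
which every single effect `N` of Alice is simulated by a response that may be as large as `tr N`.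
Such responses do not sum to one; the flag extension pays for the excess. -/
structure IsTraceBoundedModel (ρ : Matrix (m × n) (m × n) ℂ) {Λ : Type} [MeasurableSpace Λ]
    (μ : Measure Λ) (τ : Λ → Matrix n n ℂ) : Prop where
  isProbabilityMeasure : IsProbabilityMeasure μ
  measurable_apply : ∀ i j, Measurable fun l => τ l i j
  isDensity : ∀ l, IsDensity (τ l)
  entryIntegral_eq : entryIntegral μ τ = ptraceA ρ
  exists_response : ∀ N : Matrix m m ℂ, N.PosSemidef → ∃ R : Λ → ℝ, Measurable R ∧
    (∀ l, 0 ≤ R l) ∧ (∀ l, R l ≤ N.trace.re) ∧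
    entryIntegral μ (fun l => R l • τ l) = ptraceA ((N ⊗ₖ (1 : Matrix n n ℂ)) * ρ)

variable {ρ : Matrix (m × n) (m × n) ℂ} {Λ : Type} [MeasurableSpace Λ] {μ : Measure Λ}
  {τ : Λ → Matrix n n ℂ}

theorem IsTraceBoundedModel.exists_responses (h : IsTraceBoundedModel ρ μ τ) {k : ℕ}
    (N : POVM k m) : ∃ R : Fin k → Λ → ℝ, (∀ a, Measurable (R a)) ∧ (∀ a l, 0 ≤ R a l) ∧
      (∀ l, ∑ a, R a l ≤ Fintype.card m) ∧
      (∀ a i j, Integrable (fun l => (R a l • τ l) i j) μ) ∧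
      ∀ a, entryIntegral μ (fun l => R a l • τ l) =
        ptraceA ((N.elem a ⊗ₖ (1 : Matrix n n ℂ)) * ρ) := by
  have := h.isProbabilityMeasure
  choose R hR hR0 hR_le hR_int using fun a => h.exists_response (N.elem a) (N.posSemidef a)
  exact ⟨R, hR, hR0, fun l => N.sum_re_trace ▸ Finset.sum_le_sum fun a _ => hR_le a l,
    fun a => integrable_smul_density_apply (hR a) (hR0 a) (hR_le a) h.measurable_apply h.isDensity,
    hR_int⟩

theorem sum_ptraceA_kronecker_one_mul {k : ℕ} (N : POVM k m) (ρ : Matrix (m × n) (m × n) ℂ) :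
    ∑ a, ptraceA ((N.elem a ⊗ₖ (1 : Matrix n n ℂ)) * ρ) = ptraceA ρ := by
  let f : Matrix m m ℂ →+ Matrix n n ℂ :=
    .mk' (fun A => ptraceA ((A ⊗ₖ (1 : Matrix n n ℂ)) * ρ)) fun A B => by
      rw [Matrix.add_kronecker, Matrix.add_mul, ptraceA_add]
  have := map_sum f N.elem Finset.univ
  simpa [f, N.sum_eq_one] using this.symm

/-- Alice announces an outcome of the POVM compressed to `ℂ^m` with total probability
`∑ b, R b l / (d + 1)`; otherwise she pretends to have found the flag, and announces outcomes with
the probabilities `q` that they have on the flag. -/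
theorem IsTraceBoundedModel.exists_responses_flagA (h : IsTraceBoundedModel ρ μ τ) {k : ℕ}
    (M : POVM k (m ⊕ Unit)) : ∃ p : Fin k → Λ → ℝ, (∀ a, Measurable (p a)) ∧
      (∀ a l, 0 ≤ p a l) ∧ (∀ l, ∑ a, p a l = 1) ∧
      ∀ a, entryIntegral μ (fun l => p a l • τ l) =
        ptraceA ((M.elem a ⊗ₖ (1 : Matrix n n ℂ)) * flagA ρ) := by
  have := h.isProbabilityMeasure
  set N := M.compress (incl m) conjTranspose_incl_mul_incl with hN
  obtain ⟨R, hR, hR0, hR_le, hR_integrable, hR_int⟩ := h.exists_responses N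
  set D : ℝ := (Fintype.card m : ℝ)
  set q : Fin k → ℝ := fun a => (M.elem a (.inr ()) (.inr ())).re
  have hq0 (a) : 0 ≤ q a := (Complex.nonneg_iff.mp (M.posSemidef a).diag_nonneg).1
  have hq1 : ∑ a, q a = 1 := M.sum_re_apply_self (.inr ())
  have hq_eq (a) : M.elem a (.inr ()) (.inr ()) = q a :=
    Complex.eq_re_of_ofReal_le (M.posSemidef a).diag_nonneg
  refine ⟨fun a l => 1 / (D + 1) * (R a l + q a * (D + 1 - ∑ b, R b l)), fun a => by fun_prop,
    fun a l => ?_, fun l => ?_, fun a => ?_⟩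
  · have : 0 ≤ q a * (D + 1 - ∑ b, R b l) := mul_nonneg (hq0 a) (by linarith [hR_le l])
    have := hR0 a l
    positivity
  · rw [← Finset.mul_sum, Finset.sum_add_distrib, ← Finset.sum_mul, hq1]
    have : D + 1 ≠ 0 := by positivity
    field_simp
    ring
  · rw [entryIntegral_flagResponse (integrable_density_apply h.measurable_apply h.isDensity)
      h.entryIntegral_eq hR_integrable, hR_int, ptraceA_kronecker_one_mul_flagA, hq_eq,
      Complex.coe_smul, hN, POVM.compress]
    simp_rw [hR_int, sum_ptraceA_kronecker_one_mul]

theorem IsTraceBoundedModel.unsteerableAB_flagA (h : IsTraceBoundedModel ρ μ τ) :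
    UnsteerableAB (flagA ρ) := by
  intro X k M
  choose p hp hp0 hp1 hp_int using fun x => h.exists_responses_flagA (M x)
  exact ⟨Λ, _, μ, p, τ, h.isProbabilityMeasure, hp, hp0, hp1, h.measurable_apply, h.isDensity,
    fun x a => entryIntegral_smul_eq_iff.mp (hp_int x a)⟩

end TraceBounded

section Channel

variable {n n' : Type*} [Fintype n'] [Fintype n]

/-- The channel with Kraus operator `√c V` that, when the complementary effect `E` occurs instead,
prepares the state `B`. -/
noncomputable def conjOrPrepare (c : ℝ) (V : Matrix n' n ℂ) (E : Matrix n n ℂ)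
    (B : Matrix n' n' ℂ) : Matrix n n ℂ →ₗ[ℂ] Matrix n' n' ℂ where
  toFun τ := c • (V * τ * Vᴴ) + (E * τ).trace • B
  map_add' τ τ' := by
    rw [Matrix.mul_add, Matrix.mul_add, Matrix.add_mul, Matrix.trace_add]
    module
  map_smul' z τ := by
    rw [Matrix.mul_smul, Matrix.mul_smul, Matrix.smul_mul, Matrix.trace_smul, smul_eq_mul,
      RingHom.id_apply]
    module

open scoped MatrixOrder in
theorem trace_mul_nonneg {E τ : Matrix n n ℂ} (hE : E.PosSemidef) (hτ : τ.PosSemidef) :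
    0 ≤ (E * τ).trace := by
  classical
  obtain ⟨F, rfl⟩ := CStarAlgebra.nonneg_iff_eq_star_mul_self.mp hE.nonneg
  rw [Matrix.star_eq_conjTranspose, ← Matrix.trace_mul_cycle]
  exact (hτ.mul_mul_conjTranspose_same F).trace_nonneg

theorem IsDensity.conjOrPrepare [DecidableEq n] {c : ℝ} (hc : 0 ≤ c) {V : Matrix n' n ℂ}
    {E : Matrix n n ℂ} {B : Matrix n' n' ℂ} (hVE : c • (Vᴴ * V) + E = 1) (hE : E.PosSemidef)
    (hB : IsDensity B) {τ : Matrix n n ℂ} (hτ : IsDensity τ) :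
    IsDensity (conjOrPrepare c V E B τ) := by
  refine ⟨((hτ.1.mul_mul_conjTranspose_same V).smul hc).add
    (hB.1.smul (trace_mul_nonneg hE hτ.1)), ?_⟩
  change (c • (V * τ * Vᴴ) + (E * τ).trace • B).trace = 1
  rw [Matrix.trace_add, Matrix.trace_smul, Matrix.trace_smul, hB.2, smul_eq_mul, mul_one,
    Matrix.trace_mul_cycle, ← Matrix.trace_smul, ← Matrix.smul_mul, ← Matrix.trace_add,
    ← Matrix.add_mul, hVE, Matrix.one_mul, hτ.2]

theorem UnsteerableAB.flagB {m : Type*} [Fintype m] [DecidableEq m] [DecidableEq n]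
    {ρ : Matrix (m × n) (m × n) ℂ} (hρ : UnsteerableAB ρ) : UnsteerableAB (flagB ρ) := by
  intro X k M
  have hassemblage : assemblage (Steering.flagB ρ) M = fun x a =>
      conjOrPrepare (1 / ((Fintype.card n : ℝ) + 1)) (incl n)
        ((1 - 1 / ((Fintype.card n : ℝ) + 1)) • 1) (flagProj n) (assemblage ρ M x a) := by
    funext x a
    have hweight : 1 - 1 / ((Fintype.card n : ℝ) + 1) =
        1 / ((Fintype.card n : ℝ) + 1) * Fintype.card n := by
      field_simp
      ring
    refine (ptraceA_kronecker_one_mul_flagB _ ρ).trans ?_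
    simp only [conjOrPrepare, LinearMap.coe_mk, AddHom.coe_mk, Matrix.smul_mul, Matrix.one_mul,
      Matrix.trace_smul, smul_assoc, hweight, assemblage]
    module
  have hle : 1 / ((Fintype.card n : ℝ) + 1) ≤ 1 :=
    div_le_one_of_le₀ (by linarith [(Fintype.card n).cast_nonneg (α := ℝ)]) (by positivity)
  refine hassemblage ▸ (hρ X k M).map _ fun τ => IsDensity.conjOrPrepare (by positivity) ?_
    (Matrix.PosSemidef.one.smul (sub_nonneg.mpr hle)) isDensity_flagProj
  rw [conjTranspose_incl_mul_incl]
  module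

end Channel

theorem exchange_flagB_flagA {m n : Type*} [Fintype m] [DecidableEq m] [Fintype n] [DecidableEq n]
    (ρ : Matrix (m × n) (m × n) ℂ) : exchange (flagB (flagA ρ)) = flagB (flagA (exchange ρ)) := by
  simp only [flagB_flagA, exchange_smul, exchange_add, exchange_kronecker, exchange_exchange,
    Matrix.conjTranspose_kronecker, exchange_kronecker_mul_mul_kronecker, trace_exchange]
  module

/-! ### The doubly flagged Werner state -/

section Werner

variable {d : ℕ}

theorem exchange_one {m n : Type*} [DecidableEq m] [DecidableEq n] :
    exchange (1 : Matrix (m × n) (m × n) ℂ) = 1 :=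
  Matrix.submatrix_one_equiv (Equiv.prodComm n m)

theorem exchange_swapOp : exchange (swapOp d) = swapOp d := by
  ext i j
  simp [exchange, swapOp, Prod.swap_eq_iff_eq_swap]

theorem exchange_werner (α : ℝ) : exchange (werner d α) = werner d α := by
  simp only [werner, antiProj, exchange_add, exchange_sub,
    exchange_smul, exchange_one, exchange_swapOp]

theorem conjTranspose_swapOp : (swapOp d)ᴴ = swapOp d := by
  ext i j
  simp [swapOp, apply_ite star, Prod.ext_iff, and_comm, eq_comm]

theorem swapOp_mul_swapOp : swapOp d * swapOp d = 1 := by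
  ext i j
  simp [swapOp, Matrix.mul_apply, Matrix.one_apply]

theorem isStarProjection_half_smul_one_sub {A : Type*} [Ring A] [StarRing A] [Algebra ℝ A]
    [StarModule ℝ A] {B : A} (hB : IsSelfAdjoint B) (hBB : B * B = 1) :
    IsStarProjection ((1 / 2 : ℝ) • (1 - B)) where
  isIdempotentElem := by
    have hsq : (1 - B) * (1 - B) = (2 : ℝ) • (1 - B) := by
      rw [sub_mul, mul_sub, mul_sub, hBB, one_mul, mul_one, one_mul]
      module
    rw [IsIdempotentElem, smul_mul_smul_comm, hsq]
    module
  isSelfAdjoint := (IsSelfAdjoint.all _).smul ((IsSelfAdjoint.one A).sub hB)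

theorem isStarProjection_antiProj : IsStarProjection (antiProj d) :=
  isStarProjection_half_smul_one_sub conjTranspose_swapOp swapOp_mul_swapOp

theorem ptraceA_kronecker_one_mul_swapOp (N : Matrix (Fin d) (Fin d) ℂ) :
    ptraceA ((N ⊗ₖ (1 : Matrix (Fin d) (Fin d) ℂ)) * swapOp d) = N := by
  ext i j
  simp [ptraceA, swapOp, Matrix.mul_apply, Matrix.one_apply]

theorem ptraceA_kronecker_one_mul_werner (N : Matrix (Fin d) (Fin d) ℂ) (α : ℝ) :
    ptraceA ((N ⊗ₖ (1 : Matrix (Fin d) (Fin d) ℂ)) * werner d α) =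
      (α / ((d : ℝ) * ((d : ℝ) - 1))) • (N.trace • 1 - N) +
        ((1 - α) / (d : ℝ) ^ 2) • (N.trace • 1) := by
  simp only [werner, antiProj, Matrix.mul_add, Matrix.mul_sub, Matrix.mul_smul, Matrix.mul_one,
    ptraceA_add, ptraceA_sub, ptraceA_smul, ptraceA_kronecker, ptraceA_kronecker_one_mul_swapOp]
  module

theorem ptraceA_werner (hd : 2 ≤ d) (α : ℝ) : ptraceA (werner d α) = (1 / (d : ℝ)) • 1 := by
  have hd0 : (d : ℝ) ≠ 0 := by positivity
  have hd1 : (d : ℝ) - 1 ≠ 0 := sub_ne_zero.mpr (by exact_mod_cast (by lia : d ≠ 1))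
  have h := ptraceA_kronecker_one_mul_werner (1 : Matrix (Fin d) (Fin d) ℂ) α
  rw [Matrix.one_kronecker_one, Matrix.one_mul, Matrix.trace_one, Fintype.card_fin,
    ← Complex.ofReal_natCast, Complex.coe_smul] at h
  rw [h]
  match_scalars
  field_simp
  ring

open scoped MatrixOrder in
theorem isDensity_werner (hd : 2 ≤ d) {α : ℝ} (hα0 : 0 ≤ α) (hα1 : α ≤ 1) :
    IsDensity (werner d α) := by
  have hd1 : (0 : ℝ) ≤ d - 1 := sub_nonneg.mpr (by exact_mod_cast (by lia : 1 ≤ d))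
  have : 0 ≤ 1 - α := sub_nonneg.mpr hα1
  have hanti : (antiProj d).PosSemidef :=
    Matrix.nonneg_iff_posSemidef.mp isStarProjection_antiProj.nonneg
  refine ⟨(hanti.smul (by positivity)).add (Matrix.PosSemidef.one.smul (by positivity)), ?_⟩
  rw [← trace_ptraceA, ptraceA_werner hd, Matrix.trace_smul, Matrix.trace_one, Fintype.card_fin,
    Complex.real_smul]
  have : (d : ℂ) ≠ 0 := Nat.cast_ne_zero.mpr (by lia)
  push_cast
  field_simp

theorem ptraceA_kronecker_one_mul_werner_critical (hd : 2 ≤ d) {N : Matrix (Fin d) (Fin d) ℂ}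
    (hN : N.PosSemidef) :
    ptraceA ((N ⊗ₖ (1 : Matrix (Fin d) (Fin d) ℂ)) * werner d (((d : ℝ) - 1) / d)) =
      (1 / (d : ℝ) ^ 2) • (((1 + 1 / (d : ℝ)) * N.trace.re) • 1 - N) := by
  have hd0 : (d : ℝ) ≠ 0 := by positivity
  have hd1 : (d : ℝ) - 1 ≠ 0 := sub_ne_zero.mpr (by exact_mod_cast (by lia : d ≠ 1))
  rw [ptraceA_kronecker_one_mul_werner, Complex.eq_re_of_ofReal_le hN.trace_nonneg,
    Complex.coe_smul, Complex.ofReal_re]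
  match_scalars
  · field_simp
    ring
  · field_simp

theorem isTraceBoundedModel_werner (hd : 2 ≤ d) :
    IsTraceBoundedModel (werner d (((d : ℝ) - 1) / d)) (hiddenMeasure (Fin d)) hiddenState := by
  have : Nonempty (Fin d) := ⟨⟨0, by lia⟩⟩
  refine ⟨isProbabilityMeasure_hiddenMeasure _, measurable_hiddenState, isDensity_hiddenState,
    by rw [entryIntegral_hiddenState, ptraceA_werner hd, Fintype.card_fin], fun N hN => ?_⟩
  rw [ptraceA_kronecker_one_mul_werner_critical hd hN]
  exact exists_response_hiddenState hN

theorem isDensity_werner_critical (hd : 2 ≤ d) : IsDensity (werner d (((d : ℝ) - 1) / d)) :=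
  isDensity_werner hd (div_nonneg (sub_nonneg.mpr (by exact_mod_cast (by lia : 1 ≤ d))) (by simp))
    (div_le_one_of_le₀ (by linarith) (by positivity))

theorem isDensity_rhoHS (hd : 2 ≤ d) : IsDensity (rhoHS d) :=
  (isDensity_werner_critical hd).flagA.flagB

theorem rhoHS_eq (hd : 2 ≤ d) : rhoHS d = (1 / ((d : ℝ) + 1) ^ 2) •
    ((incl (Fin d) ⊗ₖ incl (Fin d)) * werner d (((d : ℝ) - 1) / d) *
        (incl (Fin d) ⊗ₖ incl (Fin d))ᴴ +
      (d : ℝ) • (flagProj (Fin d) ⊗ₖ ((1 / (d : ℝ)) • (incl (Fin d) * (incl (Fin d))ᴴ)) +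
        ((1 / (d : ℝ)) • (incl (Fin d) * (incl (Fin d))ᴴ)) ⊗ₖ flagProj (Fin d)) +
      ((d : ℝ) ^ 2) • (flagProj (Fin d) ⊗ₖ flagProj (Fin d))) := by
  rw [rhoHS, flagB_flagA, exchange_werner, ptraceA_werner hd, (isDensity_werner_critical hd).2,
    Matrix.mul_smul, Matrix.smul_mul, Matrix.mul_one, one_smul, Fintype.card_fin, ← smul_add,
    ← pow_two, ← pow_two]

theorem exchange_rhoHS : exchange (rhoHS d) = rhoHS d := by
  rw [rhoHS, exchange_flagB_flagA, exchange_werner]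

theorem unsteerableAB_rhoHS (hd : 2 ≤ d) : UnsteerableAB (rhoHS d) :=
  (isTraceBoundedModel_werner hd).unsteerableAB_flagA.flagB

theorem unsteerableBA_rhoHS (hd : 2 ≤ d) : UnsteerableBA (rhoHS d) := by
  rw [UnsteerableBA, exchange_rhoHS]
  exact unsteerableAB_rhoHS hd

end Werner

/-! ### Steering -/

theorem mul_re_trace_mul {n : Type*} [Fintype n] (c : ℝ) (A τ : Matrix n n ℂ) :
    c * (A * τ).trace.re =
      RCLike.re ((Matrix.traceLinearMap n ℂ ℂ ∘ₗ LinearMap.mulLeft ℂ A) (c • τ)) := by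
  simp

section SteeringInequality

variable {Λ n : Type*} [Fintype n] [MeasurableSpace Λ] {μ : Measure Λ} {p : Λ → ℝ}
  {τ : Λ → Matrix n n ℂ}

theorem integrable_mul_re_trace_mul (A : Matrix n n ℂ)
    (h : ∀ i j, Integrable (fun l => (p l • τ l) i j) μ) :
    Integrable (fun l => p l * (A * τ l).trace.re) μ := by
  simp_rw [mul_re_trace_mul]
  exact (integrable_map_of_integrable_apply _ h).re

theorem re_trace_mul_entryIntegral_smul (A : Matrix n n ℂ)
    (h : ∀ i j, Integrable (fun l => (p l • τ l) i j) μ) :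
    (A * entryIntegral μ (fun l => p l • τ l)).trace.re =
      ∫ l, p l * (A * τ l).trace.re ∂μ := by
  simp_rw [mul_re_trace_mul]
  rw [integral_re (integrable_map_of_integrable_apply _ h), ← map_entryIntegral _ h]
  rfl

theorem HasLHSDecomposition.sum_re_trace_mul_le {X : Type} [Fintype X] {k : X → ℕ}
    {σ : ∀ x, Fin (k x) → Matrix n n ℂ} (hσ : HasLHSDecomposition σ)
    (A : ∀ x, Fin (k x) → Matrix n n ℂ) {C : ℝ}
    (hC : ∀ (q : ∀ x, Fin (k x) → ℝ) (τ : Matrix n n ℂ), (∀ x a, 0 ≤ q x a) →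
      (∀ x, ∑ a, q x a = 1) → IsDensity τ → ∑ x, ∑ a, q x a * (A x a * τ).trace.re ≤ C) :
    ∑ x, ∑ a, (A x a * σ x a).trace.re ≤ C := by
  obtain ⟨Λ, _, μ, p, τ, _, hp, hp0, hp1, hτ_meas, hτ, hσ⟩ := hσ
  have hint (x : X) (a : Fin (k x)) (i j : n) : Integrable (fun l => (p x a l • τ l) i j) μ :=
    integrable_smul_density_apply (hp x a) (hp0 x a)
      (fun l => apply_le_one_of_sum_eq_one (hp0 x · l) (hp1 x l) a) hτ_meas hτ i j
  have hterm (x : X) (a : Fin (k x)) :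
      Integrable (fun l => p x a l * (A x a * τ l).trace.re) μ :=
    integrable_mul_re_trace_mul (A x a) (hint x a)
  have hsetting (x : X) : Integrable (fun l => ∑ a, p x a l * (A x a * τ l).trace.re) μ :=
    integrable_finsetSum _ fun a _ => hterm x a
  calc ∑ x, ∑ a, (A x a * σ x a).trace.re
      = ∫ l, ∑ x, ∑ a, p x a l * (A x a * τ l).trace.re ∂μ := by
        rw [integral_finsetSum _ fun x _ => hsetting x]
        refine Finset.sum_congr rfl fun x _ => ?_
        rw [integral_finsetSum _ fun a _ => hterm x a]
        refine Finset.sum_congr rfl fun a _ => ?_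
        rw [← re_trace_mul_entryIntegral_smul _ (hint x a), entryIntegral_smul_eq_iff.mpr (hσ x a)]
    _ ≤ ∫ _, C ∂μ := integral_mono (integrable_finsetSum _ fun x _ => hsetting x)
        (integrable_const C) fun l =>
          hC (p · · l) (τ l) (fun x a => hp0 x a l) (fun x => hp1 x l) (hτ l)
    _ = C := by rw [integral_const, probReal_univ, one_smul]

end SteeringInequality

section Isometry

theorem isStarProjection_mul_conjTranspose {m m' : Type*} [Fintype m] [DecidableEq m] [Fintype m']
    {V : Matrix m' m ℂ} (hV : Vᴴ * V = 1) : IsStarProjection (V * Vᴴ) where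
  isIdempotentElem := by
    rw [IsIdempotentElem, Matrix.mul_assoc, ← Matrix.mul_assoc Vᴴ, hV, Matrix.one_mul]
  isSelfAdjoint := Matrix.isHermitian_mul_conjTranspose_self V

variable {m n m' n' : Type*} [Fintype m] [DecidableEq m] [Fintype n] [DecidableEq n]
  [Fintype m'] [DecidableEq m'] [Fintype n'] [DecidableEq n']

open scoped MatrixOrder in
theorem posSemidef_one_sub_mul_conjTranspose {V : Matrix m' m ℂ} (hV : Vᴴ * V = 1) :
    (1 - V * Vᴴ).PosSemidef :=
  Matrix.nonneg_iff_posSemidef.mp (isStarProjection_mul_conjTranspose hV).one_sub.nonneg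

/-- The POVM that acts as `M` on the range of the isometry `V`, and on its complement announces
outcomes with the probabilities that they have under `M` in the basis state `i`. -/
noncomputable def POVM.extend {k : ℕ} (M : POVM k m) (V : Matrix m' m ℂ) (hV : Vᴴ * V = 1)
    (i : m) : POVM k m' where
  elem a := V * M.elem a * Vᴴ + M.elem a i i • (1 - V * Vᴴ)
  posSemidef a := ((M.posSemidef a).mul_mul_conjTranspose_same V).add
    ((posSemidef_one_sub_mul_conjTranspose hV).smul (M.posSemidef a).diag_nonneg)
  sum_eq_one := by
    rw [Finset.sum_add_distrib, ← Matrix.sum_mul, ← Matrix.mul_sum, ← Finset.sum_smul,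
      ← Matrix.sum_apply, M.sum_eq_one, Matrix.mul_one, Matrix.one_apply_eq, one_smul,
      add_sub_cancel]

theorem conjTranspose_mul_extend_mul {k : ℕ} (M : POVM k m) {V : Matrix m' m ℂ} (hV : Vᴴ * V = 1)
    (i : m) (a : Fin k) : Vᴴ * (M.extend V hV i).elem a * V = M.elem a := by
  have hcompl : Vᴴ * (1 - V * Vᴴ) = 0 := by
    rw [Matrix.mul_sub, Matrix.mul_one, ← Matrix.mul_assoc, hV, Matrix.one_mul, sub_self]
  rw [POVM.extend, Matrix.mul_add, Matrix.mul_smul, hcompl, smul_zero, add_zero, ← Matrix.mul_assoc,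
    ← Matrix.mul_assoc, hV, Matrix.one_mul, Matrix.mul_assoc, hV, Matrix.mul_one]

theorem SteerableAB.kronecker_conj [Nonempty m] [Nonempty n] {ρ : Matrix (m × n) (m × n) ℂ}
    (hρ : SteerableAB ρ) {V : Matrix m' m ℂ} {W : Matrix n' n ℂ} (hV : Vᴴ * V = 1)
    (hW : Wᴴ * W = 1) : SteerableAB ((V ⊗ₖ W) * ρ * (V ⊗ₖ W)ᴴ) := by
  obtain ⟨X, k, M, hM⟩ := hρ
  obtain ⟨i⟩ := ‹Nonempty m›
  obtain ⟨j⟩ := ‹Nonempty n›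
  refine ⟨X, k, fun x => (M x).extend V hV i, fun hLHS => hM ?_⟩
  have hcompl : (1 - W * Wᴴ) * W = 0 := by
    rw [Matrix.sub_mul, Matrix.one_mul, Matrix.mul_assoc, hW, Matrix.mul_one, sub_self]
  have hΦ (τ : Matrix n n ℂ) :
      conjOrPrepare 1 Wᴴ (1 - W * Wᴴ) (Matrix.single j j 1) (W * τ * Wᴴ) = τ := by
    simp only [conjOrPrepare, LinearMap.coe_mk, AddHom.coe_mk, Matrix.conjTranspose_conjTranspose]
    rw [← Matrix.mul_assoc (1 - W * Wᴴ), ← Matrix.mul_assoc (1 - W * Wᴴ), hcompl, one_smul,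
      Matrix.zero_mul, Matrix.zero_mul, Matrix.trace_zero, zero_smul, add_zero, Matrix.mul_assoc,
      Matrix.mul_assoc, hW, Matrix.mul_one, ← Matrix.mul_assoc, hW, Matrix.one_mul]
  convert hLHS.map (conjOrPrepare 1 Wᴴ (1 - W * Wᴴ) (Matrix.single j j 1)) fun τ =>
    IsDensity.conjOrPrepare zero_le_one ?_ (posSemidef_one_sub_mul_conjTranspose hW)
      (isDensity_single j) with x a
  · rw [assemblage, assemblage, ptraceA_kronecker_one_mul_conj, conjTranspose_mul_extend_mul, hΦ]
  · rw [Matrix.conjTranspose_conjTranspose, one_smul, add_sub_cancel]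

theorem SteerableBA.kronecker_conj [Nonempty m] [Nonempty n] {ρ : Matrix (m × n) (m × n) ℂ}
    (hρ : SteerableBA ρ) {V : Matrix m' m ℂ} {W : Matrix n' n ℂ} (hV : Vᴴ * V = 1)
    (hW : Wᴴ * W = 1) : SteerableBA ((V ⊗ₖ W) * ρ * (V ⊗ₖ W)ᴴ) := by
  rw [SteerableBA, Matrix.conjTranspose_kronecker, exchange_kronecker_mul_mul_kronecker,
    ← Matrix.conjTranspose_kronecker]
  exact SteerableAB.kronecker_conj hρ hW hV

end Isometry

section Qubit

open scoped MatrixOrder in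
/-- The two-outcome measurement of a projector and its complement. -/
noncomputable def POVM.ofStarProjection {m : Type*} [Fintype m] [DecidableEq m]
    {P : Matrix m m ℂ} (hP : IsStarProjection P) : POVM 2 m where
  elem := ![P, 1 - P]
  posSemidef := Fin.forall_fin_two.mpr
    ⟨Matrix.nonneg_iff_posSemidef.mp hP.nonneg, Matrix.nonneg_iff_posSemidef.mp hP.one_sub.nonneg⟩
  sum_eq_one := by simp [Fin.sum_univ_two]

/-- The Pauli matrices. -/
noncomputable def pauli : Fin 3 → Matrix (Fin 2) (Fin 2) ℂ :=
  ![!![0, 1; 1, 0], !![0, -Complex.I; Complex.I, 0], !![1, 0; 0, -1]]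

theorem pauli_mul_self (x : Fin 3) : pauli x * pauli x = 1 := by
  fin_cases x <;> ext i j <;> fin_cases i <;> fin_cases j <;> simp [pauli]

theorem isSelfAdjoint_pauli (x : Fin 3) : IsSelfAdjoint (pauli x) := by
  fin_cases x <;> ext i j <;> fin_cases i <;> fin_cases j <;> simp [pauli]

theorem trace_pauli (x : Fin 3) : (pauli x).trace = 0 := by
  fin_cases x <;> simp [pauli, Matrix.trace_fin_two]

theorem sum_sq_trace_pauli_mul (τ : Matrix (Fin 2) (Fin 2) ℂ) :
    ∑ x, (pauli x * τ).trace ^ 2 = τ.trace ^ 2 - 4 * τ.det := by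
  simp only [pauli, Matrix.trace_fin_two, Matrix.mul_apply, Fin.sum_univ_two, Fin.sum_univ_three,
    Matrix.det_fin_two, Matrix.of_apply, Matrix.cons_val', Matrix.cons_val_fin_one, Matrix.cons_val]
  linear_combination (τ 0 1 - τ 1 0) ^ 2 * Complex.I_sq

theorem sum_sq_re_trace_pauli_mul_le_one {τ : Matrix (Fin 2) (Fin 2) ℂ} (hτ : IsDensity τ) :
    ∑ x, (pauli x * τ).trace.re ^ 2 ≤ 1 := by
  have hreal (x : Fin 3) : ((pauli x * τ).trace.re : ℂ) = (pauli x * τ).trace := by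
    refine Complex.conj_eq_iff_re.mp ?_
    rw [starRingEnd_apply, ← Matrix.trace_conjTranspose, Matrix.conjTranspose_mul,
      hτ.1.isHermitian, ← Matrix.star_eq_conjTranspose, isSelfAdjoint_pauli, Matrix.trace_mul_comm]
  have hsum : ((∑ x, (pauli x * τ).trace.re ^ 2 : ℝ) : ℂ) = 1 - 4 * τ.det := by
    push_cast
    simp_rw [hreal]
    rw [sum_sq_trace_pauli_mul, hτ.2, one_pow]
  have hle : ((∑ x, (pauli x * τ).trace.re ^ 2 : ℝ) : ℂ) ≤ 1 :=
    hsum ▸ sub_le_self 1 (mul_nonneg zero_le_four hτ.1.det_nonneg)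
  exact_mod_cast hle

theorem sum_mul_le_sqrt_card {ι : Type*} [Fintype ι] {b c : ι → ℝ} (hb : ∑ x, b x ^ 2 ≤ 1)
    (hc : ∀ x, |c x| ≤ 1) : ∑ x, c x * b x ≤ √(Fintype.card ι) := by
  refine Real.le_sqrt_of_sq_le ?_
  calc (∑ x, c x * b x) ^ 2 ≤ (∑ x, c x ^ 2) * ∑ x, b x ^ 2 := Finset.sum_mul_sq_le_sq_mul_sq _ _ _
    _ ≤ (∑ _ : ι, 1) * 1 := by
        gcongr with x
        exact (sq_le_one_iff_abs_le_one _).mpr (hc x)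
    _ = Fintype.card ι := by simp

theorem HasLHSDecomposition.sum_re_trace_pauli_mul_sub_le
    {σ : Fin 3 → Fin 2 → Matrix (Fin 2) (Fin 2) ℂ}
    (hσ : HasLHSDecomposition (k := fun _ => 2) σ) :
    ∑ x, (pauli x * (σ x 0 - σ x 1)).trace.re ≤ √3 := by
  have h := hσ.sum_re_trace_mul_le (fun x => ![pauli x, -pauli x]) (C := √3)
    fun q τ hq0 hq1 hτ => ?_
  · simpa [Fin.sum_univ_two, mul_sub, ← sub_eq_add_neg] using h
  have hb := sum_mul_le_sqrt_card (c := fun x => q x 0 - q x 1)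
    (sum_sq_re_trace_pauli_mul_le_one hτ) fun x => ?_
  · simpa [Fin.sum_univ_two, sub_mul, ← sub_eq_add_neg] using hb
  · have h1 := hq1 x
    rw [Fin.sum_univ_two] at h1
    exact abs_le.mpr ⟨by linarith [hq0 x 0], by linarith [hq0 x 1]⟩

theorem trace_pauli_mul_ptraceA_werner (x : Fin 3) (N : Matrix (Fin 2) (Fin 2) ℂ) (v : ℝ) :
    (pauli x * ptraceA ((N ⊗ₖ (1 : Matrix (Fin 2) (Fin 2) ℂ)) * werner 2 v)).trace =
      (-v / 2) • (pauli x * N).trace := by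
  simp only [ptraceA_kronecker_one_mul_werner, mul_add, mul_sub, Matrix.mul_smul, Matrix.mul_one,
    Matrix.trace_add, Matrix.trace_sub, Matrix.trace_smul, trace_pauli, smul_zero, zero_sub,
    add_zero, smul_neg, ← neg_smul]
  norm_num [neg_div]

theorem steerableAB_werner_two {v : ℝ} (hv : 1 < √3 * v) : SteerableAB (werner 2 v) := by
  let M (x : Fin 3) : POVM 2 (Fin 2) := .ofStarProjection
    (isStarProjection_half_smul_one_sub (isSelfAdjoint_pauli x) (pauli_mul_self x))
  refine ⟨Fin 3, fun _ => 2, M, fun hLHS => ?_⟩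
  have hvalue (x : Fin 3) :
      (pauli x * (assemblage (werner 2 v) M x 0 - assemblage (werner 2 v) M x 1)).trace.re = v := by
    have hdiff : (M x).elem 0 - (M x).elem 1 = -pauli x := by
      simp only [M, POVM.ofStarProjection, Matrix.cons_val_zero, Matrix.cons_val_one]
      module
    rw [mul_sub, Matrix.trace_sub, assemblage, assemblage, trace_pauli_mul_ptraceA_werner,
      trace_pauli_mul_ptraceA_werner, ← smul_sub, ← Matrix.trace_sub, ← mul_sub, hdiff, mul_neg,
      pauli_mul_self, Matrix.trace_neg, Matrix.trace_one]
    simp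
  have h := hLHS.sum_re_trace_pauli_mul_sub_le
  simp_rw [hvalue] at h
  have hsqrt : √3 * √3 = 3 := Real.mul_self_sqrt (by norm_num)
  have : (3 : ℝ) * v ≤ √3 := by simpa using h
  nlinarith [Real.sqrt_nonneg 3]

theorem steerableBA_werner_two {v : ℝ} (hv : 1 < √3 * v) : SteerableBA (werner 2 v) := by
  rw [SteerableBA, exchange_werner]
  exact steerableAB_werner_two hv

end Qubit

/-! ### Local filtering -/

section Filter

variable {m n m' n' : Type*} [Fintype m] [Fintype n] [Fintype m'] [Fintype n']

open scoped MatrixOrder in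
/-- The measurement that projects onto the range of `P` or onto its orthogonal complement. -/
noncomputable def LocalMeasurement.ofStarProjection [DecidableEq m] {P : Matrix m m ℂ}
    (hP : IsStarProjection P) : LocalMeasurement 2 m where
  kraus := ![P, 1 - P]
  complete := by
    have hP' := hP.one_sub
    simp only [Fin.sum_univ_two, Matrix.cons_val_zero, Matrix.cons_val_one,
      ← Matrix.star_eq_conjTranspose, hP.isSelfAdjoint.star_eq, hP'.isSelfAdjoint.star_eq,
      hP.isIdempotentElem.eq, hP'.isIdempotentElem.eq, add_sub_cancel]

theorem filterRaw_mul_conjTranspose (V : Matrix m' m ℂ) (W : Matrix n' n ℂ)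
    (ρ : Matrix (m' × n') (m' × n') ℂ) :
    filterRaw (V * Vᴴ) (W * Wᴴ) ρ = (V ⊗ₖ W) * ((V ⊗ₖ W)ᴴ * ρ * (V ⊗ₖ W)) * (V ⊗ₖ W)ᴴ := by
  simp only [filterRaw, Matrix.mul_kronecker_mul, Matrix.conjTranspose_mul,
    Matrix.conjTranspose_conjTranspose, Matrix.conjTranspose_kronecker, Matrix.mul_assoc]

theorem filtered_eq_of_filterRaw_eq_smul {F : Matrix m m ℂ} {G : Matrix n n ℂ}
    {ρ σ : Matrix (m × n) (m × n) ℂ} {c : ℝ} (hc : c ≠ 0) (hσ : σ.trace = 1)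
    (h : filterRaw F G ρ = c • σ) : filtered F G ρ = σ := by
  have htrace : (c • σ).trace = c := by rw [Matrix.trace_smul, hσ, Complex.real_smul, mul_one]
  rw [filtered, h, htrace, ← Complex.coe_smul, inv_smul_smul₀ (Complex.ofReal_ne_zero.mpr hc)]

theorem trace_kronecker_conj [DecidableEq m] [DecidableEq n] {V : Matrix m' m ℂ} {W : Matrix n' n ℂ}
    (hV : Vᴴ * V = 1) (hW : Wᴴ * W = 1) (ρ : Matrix (m × n) (m × n) ℂ) :
    ((V ⊗ₖ W) * ρ * (V ⊗ₖ W)ᴴ).trace = ρ.trace := by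
  rw [Matrix.trace_mul_cycle, Matrix.conjTranspose_kronecker, ← Matrix.mul_kronecker_mul, hV, hW,
    Matrix.one_kronecker_one, Matrix.one_mul]

end Filter

section QubitFilter

variable {d k : ℕ}

theorem swapOp_mul_kronecker (V W : Matrix (Fin d) (Fin k) ℂ) :
    swapOp d * (V ⊗ₖ W) = (W ⊗ₖ V) * swapOp k := by
  rw [← conjTranspose_swapOp (d := d)]
  ext i j
  simp [swapOp, Matrix.mul_apply, mul_comm]

theorem conjTranspose_kronecker_mul_werner_mul_kronecker {V : Matrix (Fin d) (Fin k) ℂ}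
    (hV : Vᴴ * V = 1) (α : ℝ) :
    (V ⊗ₖ V)ᴴ * werner d α * (V ⊗ₖ V) = (α * (2 / ((d : ℝ) * ((d : ℝ) - 1)))) • antiProj k +
      ((1 - α) * (1 / (d : ℝ) ^ 2)) • 1 := by
  have hVV : (V ⊗ₖ V)ᴴ * (V ⊗ₖ V) = 1 := by
    rw [Matrix.conjTranspose_kronecker, ← Matrix.mul_kronecker_mul, hV, Matrix.one_kronecker_one]
  have hswap : (V ⊗ₖ V)ᴴ * swapOp d * (V ⊗ₖ V) = swapOp k := by
    rw [Matrix.mul_assoc, swapOp_mul_kronecker, ← Matrix.mul_assoc, hVV, Matrix.one_mul]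
  simp only [werner, antiProj, Matrix.mul_add, Matrix.mul_sub, Matrix.add_mul, Matrix.sub_mul,
    Matrix.mul_smul, Matrix.smul_mul, Matrix.mul_one, hVV, hswap]

/-- The inclusion of `ℂ^k` in `ℂ^d` as the span of the first `k` basis vectors. -/
noncomputable def castLEIncl (hk : k ≤ d) : Matrix (Fin d) (Fin k) ℂ :=
  (1 : Matrix (Fin d) (Fin d) ℂ).submatrix id (Fin.castLE hk)

theorem conjTranspose_castLEIncl_mul (hk : k ≤ d) : (castLEIncl hk)ᴴ * castLEIncl hk = 1 := by
  rw [castLEIncl, Matrix.conjTranspose_submatrix, Matrix.conjTranspose_one,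
    ← Matrix.submatrix_mul _ _ _ _ _ Function.bijective_id, Matrix.one_mul,
    Matrix.submatrix_one _ (Fin.castLE_injective hk)]

theorem qubitIncl_eq (hd : 2 ≤ d) : qubitIncl hd = incl (Fin d) * castLEIncl hd := by
  ext (i | i) j <;> fin_cases j <;>
    simp [qubitIncl, incl, castLEIncl, Matrix.fromRows_mul, Matrix.single_apply, Matrix.one_apply,
      eq_comm]

theorem conjTranspose_qubitIncl_mul (hd : 2 ≤ d) : (qubitIncl hd)ᴴ * qubitIncl hd = 1 := by
  rw [qubitIncl_eq, Matrix.conjTranspose_mul, Matrix.mul_assoc, ← Matrix.mul_assoc _ (incl _),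
    conjTranspose_incl_mul_incl, Matrix.one_mul, conjTranspose_castLEIncl_mul]

theorem qubitFilter_eq (hd : 2 ≤ d) : qubitFilter hd = qubitIncl hd * (qubitIncl hd)ᴴ := by
  simp [qubitFilter, qubitIncl, Fin.sum_univ_two, Matrix.add_mul, Matrix.mul_add]

theorem isStarProjection_qubitFilter (hd : 2 ≤ d) : IsStarProjection (qubitFilter hd) := by
  rw [qubitFilter_eq]
  exact isStarProjection_mul_conjTranspose (conjTranspose_qubitIncl_mul hd)

theorem conjTranspose_qubitIncl_mul_rhoHS_mul_qubitIncl (hd : 2 ≤ d) :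
    (qubitIncl hd ⊗ₖ qubitIncl hd)ᴴ * rhoHS d * (qubitIncl hd ⊗ₖ qubitIncl hd) =
      (2 * ((d : ℝ) + 2) / ((d : ℝ) ^ 3 * ((d : ℝ) + 1) ^ 2)) •
        werner 2 (1 / (1 + 2 / (d : ℝ))) := by
  have hd0 : (d : ℝ) ≠ 0 := by positivity
  have hd1 : (d : ℝ) - 1 ≠ 0 := sub_ne_zero.mpr (by exact_mod_cast (by lia : d ≠ 1))
  have hJ := conjTranspose_kronecker_mul_werner_mul_kronecker
    (conjTranspose_castLEIncl_mul hd) (((d : ℝ) - 1) / d)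
  calc
    _ = (castLEIncl hd ⊗ₖ castLEIncl hd)ᴴ * ((incl (Fin d) ⊗ₖ incl (Fin d))ᴴ * rhoHS d *
          (incl (Fin d) ⊗ₖ incl (Fin d))) * (castLEIncl hd ⊗ₖ castLEIncl hd) := by
      simp only [qubitIncl_eq, Matrix.mul_kronecker_mul, Matrix.conjTranspose_mul,
        Matrix.mul_assoc]
    _ = _ := by
      rw [rhoHS, conjTranspose_incl_mul_flagB_flagA_mul_incl, Matrix.mul_smul, Matrix.smul_mul,
        hJ, werner, Fintype.card_fin]
      match_scalars <;> field_simp <;> ring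

theorem filterRaw_qubitFilter_rhoHS (hd : 2 ≤ d) :
    filterRaw (qubitFilter hd) (qubitFilter hd) (rhoHS d) =
      (2 * ((d : ℝ) + 2) / ((d : ℝ) ^ 3 * ((d : ℝ) + 1) ^ 2)) •
        ((qubitIncl hd ⊗ₖ qubitIncl hd) * werner 2 (1 / (1 + 2 / (d : ℝ))) *
          (qubitIncl hd ⊗ₖ qubitIncl hd)ᴴ) := by
  rw [qubitFilter_eq, filterRaw_mul_conjTranspose, conjTranspose_qubitIncl_mul_rhoHS_mul_qubitIncl,
    Matrix.mul_smul, Matrix.smul_mul]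

theorem isDensity_werner_two {c : ℝ} (hc : 0 ≤ c) : IsDensity (werner 2 (1 / (1 + c))) :=
  isDensity_werner le_rfl (by positivity)
    (div_le_one_of_le₀ (le_add_of_nonneg_right hc) (by positivity))

theorem trace_qubitIncl_conj_werner_two (hd : 2 ≤ d) :
    ((qubitIncl hd ⊗ₖ qubitIncl hd) * werner 2 (1 / (1 + 2 / (d : ℝ))) *
      (qubitIncl hd ⊗ₖ qubitIncl hd)ᴴ).trace = 1 := by
  rw [trace_kronecker_conj (conjTranspose_qubitIncl_mul hd) (conjTranspose_qubitIncl_mul hd),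
    (isDensity_werner_two (by positivity)).2]

theorem trace_filterRaw_qubitFilter_rhoHS_ne_zero (hd : 2 ≤ d) :
    (filterRaw (qubitFilter hd) (qubitFilter hd) (rhoHS d)).trace ≠ 0 := by
  have : (2 * ((d : ℝ) + 2) / ((d : ℝ) ^ 3 * ((d : ℝ) + 1) ^ 2)) ≠ 0 := by positivity
  rw [filterRaw_qubitFilter_rhoHS, Matrix.trace_smul, trace_qubitIncl_conj_werner_two]
  exact smul_ne_zero this one_ne_zero

theorem filtered_qubitFilter_rhoHS (hd : 2 ≤ d) :
    filtered (qubitFilter hd) (qubitFilter hd) (rhoHS d) =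
      (qubitIncl hd ⊗ₖ qubitIncl hd) * werner 2 (1 / (1 + 2 / (d : ℝ))) *
        (qubitIncl hd ⊗ₖ qubitIncl hd)ᴴ :=
  filtered_eq_of_filterRaw_eq_smul (by positivity) (trace_qubitIncl_conj_werner_two hd)
    (filterRaw_qubitFilter_rhoHS hd)

theorem singlet_eq_antiProj : singlet = antiProj 2 := by
  have hsq : (√2 : ℂ)⁻¹ * (√2 : ℂ)⁻¹ = 2⁻¹ := by
    rw [← mul_inv, ← Complex.ofReal_mul, Real.mul_self_sqrt zero_le_two, Complex.ofReal_ofNat]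
  ext ⟨i, j⟩ ⟨k, l⟩
  fin_cases i <;> fin_cases j <;> fin_cases k <;> fin_cases l <;>
    simp [singlet, singletVec, antiProj, swapOp, Matrix.vecMulVec_apply, hsq]

theorem werner_two_eq {c : ℝ} (hc : 0 ≤ c) :
    werner 2 (1 / (1 + c)) = (1 / (1 + c)) • (singlet + c • ((1 / 4 : ℝ) • 1)) := by
  have : 1 + c ≠ 0 := by positivity
  rw [singlet_eq_antiProj, werner]
  match_scalars <;> field_simp <;> ring

theorem one_lt_sqrt_three_mul_visibility (hd : 3 ≤ d) : 1 < √3 * (1 / (1 + 2 / (d : ℝ))) := by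
  have hd' : (3 : ℝ) ≤ d := by exact_mod_cast hd
  have h2 : 2 / (d : ℝ) ≤ 2 / 3 := by gcongr
  have hsqrt : 5 / 3 < √3 := Real.lt_sqrt_of_sq_lt (by norm_num)
  rw [mul_one_div, one_lt_div (by positivity)]
  linarith

theorem steerableAB_filtered_rhoHS (hd : 3 ≤ d) :
    SteerableAB (filtered (qubitFilter (Nat.le_of_succ_le hd))
      (qubitFilter (Nat.le_of_succ_le hd)) (rhoHS d)) := by
  have hQ := conjTranspose_qubitIncl_mul (Nat.le_of_succ_le hd)
  rw [filtered_qubitFilter_rhoHS]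
  exact (steerableAB_werner_two (one_lt_sqrt_three_mul_visibility hd)).kronecker_conj hQ hQ

theorem steerableBA_filtered_rhoHS (hd : 3 ≤ d) :
    SteerableBA (filtered (qubitFilter (Nat.le_of_succ_le hd))
      (qubitFilter (Nat.le_of_succ_le hd)) (rhoHS d)) := by
  have hQ := conjTranspose_qubitIncl_mul (Nat.le_of_succ_le hd)
  rw [filtered_qubitFilter_rhoHS]
  exact (steerableBA_werner_two (one_lt_sqrt_three_mul_visibility hd)).kronecker_conj hQ hQ

theorem hasHiddenSteering_rhoHS (hd : 3 ≤ d) : HasHiddenSteering (rhoHS d) :=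
  have hd' : 2 ≤ d := Nat.le_of_succ_le hd
  let test := LocalMeasurement.ofStarProjection (isStarProjection_qubitFilter hd')
  ⟨unsteerableAB_rhoHS hd', unsteerableBA_rhoHS hd', 2, 2, test, test, 0, 0,
    trace_filterRaw_qubitFilter_rhoHS_ne_zero hd', .inl (steerableAB_filtered_rhoHS hd)⟩

end QubitFilter

end Steering

theorem mainTheorem5 (d : ℕ) (hd : 2 ≤ d) :
    -- the doubly flagged Werner state is a quantum state, given by the following formula
    Steering.IsDensity (Steering.rhoHS d) ∧
    Steering.rhoHS d = (1 / ((d : ℝ) + 1) ^ 2) •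
      ((Steering.incl (Fin d) ⊗ₖ Steering.incl (Fin d)) *
          Steering.werner d (((d : ℝ) - 1) / d) *
          (Steering.incl (Fin d) ⊗ₖ Steering.incl (Fin d))ᴴ
        + (d : ℝ) •
          (Steering.flagProj (Fin d) ⊗ₖ
              ((1 / (d : ℝ)) • (Steering.incl (Fin d) * (Steering.incl (Fin d))ᴴ))
            + ((1 / (d : ℝ)) • (Steering.incl (Fin d) * (Steering.incl (Fin d))ᴴ)) ⊗ₖ
              Steering.flagProj (Fin d))
        + ((d : ℝ) ^ 2) • (Steering.flagProj (Fin d) ⊗ₖ Steering.flagProj (Fin d))) ∧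
    -- it admits LHS models for POVMs in both directions
    Steering.UnsteerableAB (Steering.rhoHS d) ∧
    Steering.UnsteerableBA (Steering.rhoHS d) ∧
    -- local filtering on both sides succeeds with non-zero probability and yields the two-qubit
    -- Werner state with visibility `1 / (1 + 2 / d)`
    (Steering.filterRaw (Steering.qubitFilter hd) (Steering.qubitFilter hd)
      (Steering.rhoHS d)).trace ≠ 0 ∧
    Steering.filtered (Steering.qubitFilter hd) (Steering.qubitFilter hd) (Steering.rhoHS d) =
      (Steering.qubitIncl hd ⊗ₖ Steering.qubitIncl hd) *
        Steering.werner 2 (1 / (1 + 2 / (d : ℝ))) *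
        (Steering.qubitIncl hd ⊗ₖ Steering.qubitIncl hd)ᴴ ∧
    Steering.werner 2 (1 / (1 + 2 / (d : ℝ))) =
      (1 / (1 + 2 / (d : ℝ))) •
        (Steering.singlet + (2 / (d : ℝ)) • ((1 / 4 : ℝ) • 1)) ∧
    -- for `d ≥ 3` this state is steerable in both directions, so there is hidden steering
    (3 ≤ d →
      Steering.SteerableAB (Steering.werner 2 (1 / (1 + 2 / (d : ℝ)))) ∧
      Steering.SteerableBA (Steering.werner 2 (1 / (1 + 2 / (d : ℝ)))) ∧
      Steering.SteerableAB (Steering.filtered (Steering.qubitFilter hd)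
        (Steering.qubitFilter hd) (Steering.rhoHS d)) ∧
      Steering.SteerableBA (Steering.filtered (Steering.qubitFilter hd)
        (Steering.qubitFilter hd) (Steering.rhoHS d)) ∧
      Steering.HasHiddenSteering (Steering.rhoHS d)) := by
  refine ⟨Steering.isDensity_rhoHS hd, Steering.rhoHS_eq hd, Steering.unsteerableAB_rhoHS hd,
    Steering.unsteerableBA_rhoHS hd, Steering.trace_filterRaw_qubitFilter_rhoHS_ne_zero hd,
    Steering.filtered_qubitFilter_rhoHS hd, Steering.werner_two_eq (by positivity), fun hd3 => ?_⟩
  have hv := Steering.one_lt_sqrt_three_mul_visibility hd3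
  exact ⟨Steering.steerableAB_werner_two hv, Steering.steerableBA_werner_two hv,
    Steering.steerableAB_filtered_rhoHS hd3, Steering.steerableBA_filtered_rhoHS hd3,
    Steering.hasHiddenSteering_rhoHS hd3⟩
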